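/- Model. There are $k\ge 1$ players; player $i$ holds an input $X_i$, a private random tape $R_i$, and all players see a public random tape $R^p$. Each random tape takes values in an arbitrary probability space, and $X,R_1,\dots,R_k,R^p$ are independent. Every ordered pair of players is joined by a FIFO link with finite but unbounded delays. A protocol runs in local rounds: in each local round, depending on its current view (its input, its private tape, the public tape and the messages it has read so far), player $i$ sends bit strings to some set of other players, possibly writes on its output tape, and then waits for one message from each player in some set. A player writes on its output tape in at most one local round. For all inputs and tapes the protocol eventually stops, i.e. only finitely many messages are sent. Messages are self-delimiting (on each link no message is a proper prefix of another). The protocol is oblivious if the sets of players to which player $i$ sends, and for which it waits, in its $j$-th local round depend only on $i$ and $j$. The transcript $\Pi_i$ of player $i$ is the sequence of the messages it reads. For an input distribution $\mu$, the public information cost of a protocol $\pi$ is $$\mathsf{PIC}_\mu(\pi)=\sum_{i=1}^k I\bigl(X_{-i};\,\Pi_i R_{-i}\mid X_i R_i R^p\bigr)$$ (in bits), where $X_{-i}=(X_q)_{q\ne i}$ and $R_{-i}=(R_q)_{q\neq i}$. Task. In the parity function $\mathsf{Par}_k^n$ ($n\ge 0$) player $i$ holds $x_i\in\{0,1\}^n$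 and player 1 has to output $\bigl(\bigoplus_{i=1}^k x_i^p\bigr)_{1\le p\le n}$. A protocol computes it with zero error if on every input player 1 writes an output for all values of the tapes, and with probability one it writes the correct value. In the relaxed version any player may write bits for any subset of the coordinates; on every input and for all values of the tapes every coordinate has to be written by some player, which may depend on the coordinate, the input and the tapes, and with probability one all bits that are written are correct. Theorem. Let $\mu$ be the uniform distribution on $(\{0,1\}^n)^k$. Every oblivious protocol $\pi$ that computes $\mathsf{Par}_k^n$ with zero error satisfies $\mathsf{PIC}_\mu(\pi)\ge n(k-1)$, and so does every oblivious protocol that computes it with zero error in the relaxed sense (for these lower bounds the messages need not be self-delimiting). For every choice of the random sources, both bounds are attained by some oblivious zero-error protocol; hence the infimum $\mathsf{PIC}^0_\mu(\mathsf{Par}_k^n)$ of $\mathsf{PIC}_\mu(\pi)$ over all oblivious protocols $\pi$ that compute $\mathsf{Par}_k^n$ with zero error equals $n(k-1)$, and the same holds in the relaxed version. -/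

import Mathlib

open MeasureTheory ProbabilityTheory

noncomputable section

/-! ### Information theory -/

/-- Conditional entropy in bits, `H(X | Z) = E_z [∑ a, P[X = a | z] log₂ (1 / P[X = a | z])]`, of a
random variable `X` with finitely many values; the conditioning variable `Z` (of any kind) is given
by the σ-algebra `m` it generates. -/
def condEntropy {S A : Type*} [Fintype A] (m : MeasurableSpace S) [MeasurableSpace S]
    (μ : Measure S) (X : S → A) : ℝ :=
  ∫ s, ∑ a, Real.negMulLog ((μ⟦X ⁻¹' {a} | m⟧) s) / Real.log 2 ∂μ

/-- Conditional mutual information `I(X ; Y | Z) = H(X | Z) - H(X | Y Z)`, where `mY` and `mZ` are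
the σ-algebras generated by `Y` and `Z`. -/
def condMutualInfo {S A : Type*} [Fintype A] (mY mZ : MeasurableSpace S) [MeasurableSpace S]
    (μ : Measure S) (X : S → A) : ℝ :=
  condEntropy mZ μ X - condEntropy (mY ⊔ mZ) μ X

/-! ### The asynchronous peer-to-peer model -/

/-- The messages that a player has received, one entry for each local round it has completed: the
entry gives the message read from player `q` in that round, and `none` if the player did not wait
for player `q` in that round. -/
abbrev History (k : ℕ) : Type := List (Fin k → Option (List Bool))

/-- The view of a player: its input, its private randomness, the public randomness, and the messages
received so far. The number of completed local rounds is `received.length`. -/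
structure View (k : ℕ) (α R P : Type*) where
  input : α
  priv : R
  pub : P
  received : History k

/-- A `k`-player protocol with inputs in `α`, private randomness of player `i` in `Ω i`, public
randomness in `P`, and outputs in `β`. Every local round of a player is governed by its view at the
end of the previous local round: the player sends `message i v q` to every `q ∈ sendTo i v`, writes
`output i v` on its output tape (`none` if it writes nothing), and then waits for one message from
each `q ∈ waitFor i v`, which ends the round. (The view determines the number of the round.) All
these are random variables, i.e. measurable in the randomness. -/
structure Protocol (k : ℕ) (α : Type*) (Ω : Fin k → Type*) (P : Type*) (β : Type*)
    [∀ i, MeasurableSpace (Ω i)] [MeasurableSpace P] where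
  sendTo : ∀ i, View k α (Ω i) P → Finset (Fin k)
  message : ∀ i, View k α (Ω i) P → Fin k → List Bool
  output : ∀ i, View k α (Ω i) P → Option β
  waitFor : ∀ i, View k α (Ω i) P → Finset (Fin k)
  notMem_sendTo : ∀ i v, i ∉ sendTo i v
  notMem_waitFor : ∀ i v, i ∉ waitFor i v
  measurable_sendTo : ∀ i a h s,
    MeasurableSet {r : Ω i × P | sendTo i ⟨a, r.1, r.2, h⟩ = s}
  measurable_message : ∀ i a h q m,
    MeasurableSet {r : Ω i × P | message i ⟨a, r.1, r.2, h⟩ q = m}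
  measurable_output : ∀ i a h o,
    MeasurableSet {r : Ω i × P | output i ⟨a, r.1, r.2, h⟩ = o}
  measurable_waitFor : ∀ i a h s,
    MeasurableSet {r : Ω i × P | waitFor i ⟨a, r.1, r.2, h⟩ = s}

namespace Protocol

variable {k : ℕ} {α : Type*} {Ω : Fin k → Type*} {P β : Type*}
  [∀ i, MeasurableSpace (Ω i)] [MeasurableSpace P]

/-- The view of player `i` with history `h`, for the input `x` and the random tapes `r`. -/
def view (x : Fin k → α) (r : (∀ i, Ω i) × P) (i : Fin k) (h : History k) :
    View k α (Ω i) P :=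
  ⟨x i, r.1 i, r.2, h⟩

/-- The messages put by player `q` on its link to player `i`, in order, when player `q` has history
`h`: those of its completed local rounds and of its current local round. -/
def sent (π : Protocol k α Ω P β) (x : Fin k → α) (r : (∀ i, Ω i) × P) (q i : Fin k)
    (h : History k) : List (List Bool) :=
  (List.range (h.length + 1)).filterMap fun j =>
    if i ∈ π.sendTo q (view x r q (h.take j)) then
      some (π.message q (view x r q (h.take j)) i)
    else none

/-- The first message on the FIFO link from player `q` to player `i` that player `i` has not read
yet (`none` if there is none), when the histories are `H`. -/
def nextMessage (π : Protocol k α Ω P β) (x : Fin k → α) (r : (∀ i, Ω i) × P)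
    (H : Fin k → History k) (q i : Fin k) : Option (List Bool) :=
  (π.sent x r q i (H q))[(H i).countP fun e => (e q).isSome]?

open Classical in
/-- Player `i` completes its current local round if a message from each player that it waits for is
there, and goes on waiting otherwise. -/
def advance (π : Protocol k α Ω P β) (x : Fin k → α) (r : (∀ i, Ω i) × P)
    (H : Fin k → History k) (i : Fin k) : History k :=
  if ∀ q ∈ π.waitFor i (view x r i (H i)), (π.nextMessage x r H q i).isSome then
    H i ++ [fun q =>
      if q ∈ π.waitFor i (view x r i (H i)) then π.nextMessage x r H q i else none]
  else H i

/-- The histories of all players in the execution on input `x` with random tapes `r`. As every link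
is FIFO and a player waits for a set of players fixed by its own view, the sequence of views that a
player goes through does not depend on the delays of the messages. So the run in which all messages
arrive without delay is representative; `t` counts its steps. -/
def run (π : Protocol k α Ω P β) (x : Fin k → α) (r : (∀ i, Ω i) × P) :
    ℕ → Fin k → History k
  | 0 => fun _ => []
  | t + 1 => π.advance x r (run π x r t)

/-- The sequence of all messages read in a history, ordered by local round, and within a round by
the index of the sender. -/
def messagesRead (h : History k) : List (List Bool) :=
  h.flatMap fun e => (List.finRange k).filterMap e

open Classical in
/-- The transcript `Π_i` of player `i`: the sequence of all messages that it reads in the entire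
execution (with a default value if the execution does not stop). -/
def transcript (π : Protocol k α Ω P β) (x : Fin k → α) (r : (∀ i, Ω i) × P) (i : Fin k) :
    List (List Bool) :=
  if h : ∃ l, ∀ᶠ t in Filter.atTop, messagesRead (π.run x r t i) = l then h.choose else []

/-- Player `i` writes `y` on its output tape at some point of the execution. -/
def Writes (π : Protocol k α Ω P β) (x : Fin k → α) (r : (∀ i, Ω i) × P) (i : Fin k) (y : β) :
    Prop :=
  ∃ t, π.output i (view x r i (π.run x r t i)) = some y

/-- The protocol eventually stops: on all inputs and all random tapes, from some time on no message
is sent any more. -/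
def Stops (π : Protocol k α Ω P β) : Prop :=
  ∀ x r, ∃ T, ∀ t, T ≤ t → ∀ q i,
    π.sent x r q i (π.run x r t q) = π.sent x r q i (π.run x r T q)

/-- A player writes on its output tape in at most one local round. -/
def WritesOnce (π : Protocol k α Ω P β) : Prop :=
  ∀ x r i s t,
    (π.output i (view x r i (π.run x r s i))).isSome →
    (π.output i (view x r i (π.run x r t i))).isSome →
    (π.run x r s i).length = (π.run x r t i).length

/-- Messages are self-delimiting: on every link, no message is a proper prefix of another one. -/
def SelfDelimiting (π : Protocol k α Ω P β) : Prop :=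
  ∀ i q v w, q ∈ π.sendTo i v → q ∈ π.sendTo i w →
    π.message i v q <+: π.message i w q → π.message i v q = π.message i w q

/-- In an oblivious protocol the sets of players to which player `i` sends, and for which it waits,
depend only on `i` and on the number of the local round. -/
def Oblivious (π : Protocol k α Ω P β) : Prop :=
  ∃ S W : Fin k → ℕ → Finset (Fin k), ∀ i v,
    π.sendTo i v = S i v.received.length ∧ π.waitFor i v = W i v.received.length

/-- The public information cost `∑ i, I(X_{-i} ; Π_i R_{-i} | X_i R_i R^p)`, where the input `X` has
distribution `μ`, and `X`, the private random tapes `R_i ∼ ρ i` and the public random tape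
`R^p ∼ τ` are independent. -/
def publicInfoCost [Fintype α] [MeasurableSpace α] (π : Protocol k α Ω P β)
    (μ : Measure (Fin k → α)) (ρ : ∀ i, Measure (Ω i)) (τ : Measure P) : ℝ :=
  ∑ i, condMutualInfo (S := (Fin k → α) × (∀ q, Ω q) × P)
    (MeasurableSpace.comap (fun s => π.transcript s.1 s.2 i) ⊤ ⊔
      MeasurableSpace.comap (fun s (q : {q // q ≠ i}) => s.2.1 q) inferInstance)
    (MeasurableSpace.comap (fun s => (s.1 i, s.2.1 i, s.2.2)) inferInstance)
    (μ.prod ((Measure.pi ρ).prod τ))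
    (fun s (q : {q // q ≠ i}) => s.1 q)

end Protocol

/-! ### The parity function -/

/-- The bitwise parity of `k` strings of `n` bits. -/
def parity {k n : ℕ} (x : Fin k → Fin n → Bool) (p : Fin n) : Bool :=
  (List.finRange k).foldl (fun b i => b ^^ x i p) false

/-- The uniform distribution on the inputs. -/
def uniformInput (k n : ℕ) : Measure (Fin k → Fin n → Bool) := uniformOn Set.univ

section Parity

variable {k n : ℕ} {Ω : Fin k → Type*} {P : Type*}
  [∀ i, MeasurableSpace (Ω i)] [MeasurableSpace P]

/-- The protocol computes the parity function with zero error: on every input, the first player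
writes an output for all random tapes, and with probability one what it writes is the bitwise
parity. -/
def ComputesParity [NeZero k] (π : Protocol k (Fin n → Bool) Ω P (Fin n → Bool))
    (ρ : ∀ i, Measure (Ω i)) (τ : Measure P) : Prop :=
  ∀ x, (∀ r, ∃ y, π.Writes x r 0 y) ∧
    ∀ᵐ r ∂(Measure.pi ρ).prod τ, ∀ y, π.Writes x r 0 y → y = parity x

/-- The protocol computes the parity function with zero error in the relaxed sense that any player
may output any of the coordinates (a player writes bits for a subset of the coordinates): on every
input, for all random tapes every coordinate is output by some player, which may depend on the
coordinate, the input and the random tapes; and with probability one all bits written are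
correct. -/
def ComputesParityJointly (π : Protocol k (Fin n → Bool) Ω P (Fin n → Option Bool))
    (ρ : ∀ i, Measure (Ω i)) (τ : Measure P) : Prop :=
  ∀ x, (∀ r p, ∃ i y, π.Writes x r i y ∧ (y p).isSome) ∧
    ∀ᵐ r ∂(Measure.pi ρ).prod τ, ∀ i y, π.Writes x r i y →
      ∀ p b, y p = some b → b = parity x p

/-- The public information costs, under the uniform distribution, of all oblivious protocols that
satisfy `C` and obey the rules of the model (they stop, write once, and use self-delimiting
messages). -/
def obliviousCosts {β : Type*} (C : Protocol k (Fin n → Bool) Ω P β → Prop)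
    (ρ : ∀ i, Measure (Ω i)) (τ : Measure P) : Set ℝ :=
  {c | ∃ π : Protocol k (Fin n → Bool) Ω P β,
    π.Oblivious ∧ π.Stops ∧ π.WritesOnce ∧ π.SelfDelimiting ∧ C π ∧
      π.publicInfoCost (uniformInput k n) ρ τ = c}

/-- The zero-error public information complexity `PIC⁰_μ` of the parity function for oblivious
protocols and the uniform distribution `μ`. -/
def parityPIC (k n : ℕ) [NeZero k] {Ω : Fin k → Type*} {P : Type*}
    [∀ i, MeasurableSpace (Ω i)] [MeasurableSpace P]
    (ρ : ∀ i, Measure (Ω i)) (τ : Measure P) : ℝ :=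
  sInf (obliviousCosts (k := k) (n := n) (fun π => ComputesParity π ρ τ) ρ τ)

/-- The same quantity for protocols in which any player may output any of the coordinates. -/
def jointParityPIC (k n : ℕ) {Ω : Fin k → Type*} {P : Type*}
    [∀ i, MeasurableSpace (Ω i)] [MeasurableSpace P]
    (ρ : ∀ i, Measure (Ω i)) (τ : Measure P) : ℝ :=
  sInf (obliviousCosts (k := k) (n := n) (fun π => ComputesParityJointly π ρ τ) ρ τ)

end Parity

end

/-! Fix the random tapes. Since the input `X` is uniform, whatever a set of players knows about it
is an equivalence relation on inputs (those not yet distinguished), and the remaining uncertainty is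
the mean logarithm of the class size. In `PIC`, the posterior of player `i` conditions on all tapes,
and the prior uncertainty about `X_{-i}` is `(k - 1) n` whatever the tapes. Hence `PIC` is the
average over the tapes of the total uncertainty lost by the individual players
(`publicInfoCost_uniformOn`), and a bound for almost all fixed tapes suffices.

For fixed tapes, compare two knowledge states: that of a single player `i`, and the joint one of all
players except `q`. A message from `q` to `i` refines both. The joint state of all but `q` is finer
than that of `i`, so by strong subadditivity the message removes at most as much uncertainty from it
as from player `i`. Messages between two players other than `q` tell that group nothing new. Summing
over messages, the total loss of the individual players is at least the sum over `q` of the loss of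
the players other than `q` (`sum_othersSetoid_le_sum_viewSetoid`).

At the end, for each input and coordinate `p`, some player knows the parity bit. For each of the `k
- 1` values of `q` different from that player, the players other than `q` know this bit and all
inputs but `x_q`, hence also bit `p` of `x_q`. Each of the `n` coordinates thus contributes `k - 1`
bits (`le_sum_classEntropy`).

Obliviousness makes the communication pattern independent of inputs and tapes. So silence and timing
carry no information, the transcript determines the history, and one finite time ends all
transcripts simultaneously. The bound is attained when all players send their inputs to player 1:
only player 1 learns anything, namely the other `n (k - 1)` bits. -/

noncomputable section

/-! ### Entropy of equivalence relations on a finite set -/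

namespace Setoid

variable {X : Type*}

/-- The relation `s`, refined by the `m p` with `p ∈ S`. -/
def refine {ι : Type*} (s : Setoid X) (m : ι → Setoid X) (S : Finset ι) : Setoid X :=
  s ⊓ ⨅ p ∈ S, m p

theorem refine_le {ι : Type*} {s : Setoid X} {m : ι → Setoid X} {S : Finset ι} :
    s.refine m S ≤ s := inf_le_left

theorem refine_le_of_mem {ι : Type*} {s : Setoid X} {m : ι → Setoid X} {S : Finset ι} {p : ι}
    (hp : p ∈ S) : s.refine m S ≤ m p :=
  inf_le_right.trans (iInf₂_le p hp)

theorem refine_insert {ι : Type*} [DecidableEq ι] (s : Setoid X) (m : ι → Setoid X)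
    (S : Finset ι) (p : ι) : s.refine m (insert p S) = s.refine m S ⊓ m p := by
  unfold refine
  rw [Finset.iInf_insert, inf_comm (m p), inf_assoc]

variable [Fintype X]

open Classical in
/-- The number of elements of the equivalence class of `x`. -/
def classCard (s : Setoid X) (x : X) : ℕ := (Finset.univ.filter fun y => s x y).card

/-- The sum over all points of the logarithm of the size of its class, i.e. up to normalization
the conditional entropy of a uniformly distributed point given its class. -/
def classEntropy (s : Setoid X) : ℝ := ∑ x, Real.logb 2 (s.classCard x)

theorem classCard_pos (s : Setoid X) (x : X) : 0 < s.classCard x := by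
  classical
  exact Finset.card_pos.2 ⟨x, by simp⟩

theorem classCard_le_card (s : Setoid X) (x : X) : s.classCard x ≤ Fintype.card X := by
  classical
  exact Finset.card_le_univ _

theorem classCard_eq_of_rel (s : Setoid X) {x y : X} (h : s x y) :
    s.classCard x = s.classCard y := by
  classical
  unfold classCard
  congr 1
  ext z
  simp only [Finset.mem_filter, Finset.mem_univ, true_and]
  exact ⟨fun hz => s.trans (s.symm h) hz, fun hz => s.trans h hz⟩

theorem classCard_mono {s t : Setoid X} (h : s ≤ t) (x : X) :
    s.classCard x ≤ t.classCard x := by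
  classical
  refine Finset.card_le_card fun y hy => ?_
  simp only [Finset.mem_filter, Finset.mem_univ, true_and] at hy ⊢
  exact h hy

theorem classEntropy_mono {s t : Setoid X} (h : s ≤ t) : s.classEntropy ≤ t.classEntropy := by
  refine Finset.sum_le_sum fun x _ => ?_
  exact Real.logb_le_logb_of_le (by norm_num) (by exact_mod_cast s.classCard_pos x)
    (by exact_mod_cast classCard_mono h x)

open Classical in
-- The points satisfying `p` lie in a single class, whose elements have weights summing to 1.
theorem sum_inv_classCard_le_one (s : Setoid X) (p : X → Prop)
    (hp : ∀ x y, p x → p y → s x y) :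
    ∑ x, (if p x then (s.classCard x : ℝ)⁻¹ else 0) ≤ 1 := by
  by_cases h : ∃ x, p x
  · obtain ⟨x₀, h₀⟩ := h
    calc ∑ x, (if p x then (s.classCard x : ℝ)⁻¹ else 0)
        ≤ ∑ x, (if s x₀ x then (s.classCard x₀ : ℝ)⁻¹ else 0) := by
          refine Finset.sum_le_sum fun x _ => ?_
          by_cases hx : p x
          · rw [if_pos hx, if_pos (hp _ _ h₀ hx), s.classCard_eq_of_rel (hp _ _ h₀ hx)]
          · rw [if_neg hx]; split_ifs <;> positivity
      _ = 1 := by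
          rw [← Finset.sum_filter, Finset.sum_const, nsmul_eq_mul]
          exact mul_inv_cancel₀ (by exact_mod_cast (s.classCard_pos x₀).ne')
  · push Not at h
    simp [h]

open Classical in
-- The numerator counts pairs `(y, z)` with `a x y` and `b x z`. For a fixed pair, all such `x` lie
-- in one class of `a ⊓ b`, so their weights sum to at most the inverse size of the `c`-class that
-- contains `y` and `z`. Summing over pairs in a common `c`-class gives the number of points.
theorem sum_mul_div_le_card {a b c : Setoid X} (ha : a ≤ c) (hb : b ≤ c) :
    ∑ x, (a.classCard x * b.classCard x : ℝ) / ((a ⊓ b).classCard x * c.classCard x)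
      ≤ Fintype.card X := by
  have h1 : ∀ x, (a.classCard x * b.classCard x : ℝ) / ((a ⊓ b).classCard x * c.classCard x)
      = ∑ y, ∑ z, if a x y ∧ b x z then
          ((a ⊓ b).classCard x : ℝ)⁻¹ * (c.classCard x : ℝ)⁻¹ else 0 := by
    intro x
    have : (a.classCard x * b.classCard x : ℝ) =
        ∑ y, ∑ z, if a x y ∧ b x z then (1 : ℝ) else 0 := by
      have ea : (a.classCard x : ℝ) = ∑ y, if a x y then (1 : ℝ) else 0 := by
        simp [classCard]
      have eb : (b.classCard x : ℝ) = ∑ y, if b x y then (1 : ℝ) else 0 := by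
        simp [classCard]
      rw [ea, eb, Finset.sum_mul_sum]
      refine Finset.sum_congr rfl fun y _ => Finset.sum_congr rfl fun z _ => ?_
      by_cases h1 : a x y <;> by_cases h2 : b x z <;> simp [h1, h2]
    rw [this, div_eq_mul_inv, mul_inv, Finset.sum_mul]
    refine Finset.sum_congr rfl fun y _ => ?_
    rw [Finset.sum_mul]
    refine Finset.sum_congr rfl fun z _ => ?_
    split_ifs <;> simp
  calc ∑ x, (a.classCard x * b.classCard x : ℝ) / ((a ⊓ b).classCard x * c.classCard x)
      = ∑ y, ∑ z, ∑ x, if a x y ∧ b x z then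
          ((a ⊓ b).classCard x : ℝ)⁻¹ * (c.classCard x : ℝ)⁻¹ else 0 := by
        simp_rw [h1]
        rw [Finset.sum_comm]
        exact Finset.sum_congr rfl fun y _ => Finset.sum_comm
    _ ≤ ∑ y, ∑ z, if c y z then (c.classCard y : ℝ)⁻¹ else 0 := by
        refine Finset.sum_le_sum fun y _ => Finset.sum_le_sum fun z _ => ?_
        by_cases hyz : c y z
        · rw [if_pos hyz]
          have := (a ⊓ b).sum_inv_classCard_le_one (fun x => a x y ∧ b x z)
            (fun x x' h h' => ⟨a.trans h.1 (a.symm h'.1), b.trans h.2 (b.symm h'.2)⟩)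
          calc _ = (∑ x, if a x y ∧ b x z then ((a ⊓ b).classCard x : ℝ)⁻¹ else 0)
                * (c.classCard y : ℝ)⁻¹ := by
                rw [Finset.sum_mul]
                refine Finset.sum_congr rfl fun x _ => ?_
                split_ifs with h
                · rw [c.classCard_eq_of_rel (ha h.1)]
                · simp
            _ ≤ 1 * (c.classCard y : ℝ)⁻¹ := by
                refine mul_le_mul_of_nonneg_right (le_of_eq_of_le ?_ this) (by positivity)
                congr!
            _ = _ := one_mul _
        · rw [if_neg hyz]
          refine (Finset.sum_eq_zero fun x _ => if_neg fun h => hyz ?_).le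
          exact c.trans (c.symm (ha h.1)) (hb h.2)
    _ = Fintype.card X := by
        have : ∀ y, (∑ z, if c y z then (c.classCard y : ℝ)⁻¹ else 0) = 1 := by
          intro y
          rw [← Finset.sum_filter, Finset.sum_const, nsmul_eq_mul]
          exact mul_inv_cancel₀ (by exact_mod_cast (c.classCard_pos y).ne')
        simp [this]

/-- Strong subadditivity. -/
theorem classEntropy_add_le {a b c : Setoid X} (ha : a ≤ c) (hb : b ≤ c) :
    a.classEntropy + b.classEntropy ≤ c.classEntropy + (a ⊓ b).classEntropy := by
  have pos : ∀ (s : Setoid X) x, (0 : ℝ) < s.classCard x := fun s x => by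
    exact_mod_cast s.classCard_pos x
  -- The bound `log t ≤ t - 1` plays the role of Jensen's inequality; the mean of `t` is at most 1
  -- by `sum_mul_div_le_card`.
  have key : ∀ x, Real.log (a.classCard x) + Real.log (b.classCard x)
      - Real.log (c.classCard x) - Real.log ((a ⊓ b).classCard x) ≤
      (a.classCard x * b.classCard x : ℝ) / ((a ⊓ b).classCard x * c.classCard x) - 1 := by
    intro x
    have := Real.log_le_sub_one_of_pos
      (div_pos (mul_pos (pos a x) (pos b x)) (mul_pos (pos (a ⊓ b) x) (pos c x)))
    rw [Real.log_div (mul_pos (pos a x) (pos b x)).ne' (mul_pos (pos (a ⊓ b) x) (pos c x)).ne',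
      Real.log_mul (pos a x).ne' (pos b x).ne',
      Real.log_mul (pos (a ⊓ b) x).ne' (pos c x).ne'] at this
    linarith
  have hsum := Finset.sum_le_sum fun x (_ : x ∈ Finset.univ) => key x
  have hcard := sum_mul_div_le_card ha hb
  simp only [Finset.sum_sub_distrib, Finset.sum_add_distrib, Finset.sum_const, nsmul_eq_mul,
    mul_one, Finset.card_univ] at hsum
  have h2 : (0 : ℝ) < Real.log 2 := Real.log_pos (by norm_num)
  simp only [classEntropy, Real.logb, ← Finset.sum_div]
  rw [← add_div, ← add_div]
  exact div_le_div_of_nonneg_right (by linarith) h2.le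

/-- Refining by `m` costs less on a finer relation. -/
theorem classEntropy_sub_inf_le {a b : Setoid X} (h : b ≤ a) (m : Setoid X) :
    b.classEntropy - (b ⊓ m).classEntropy ≤ a.classEntropy - (a ⊓ m).classEntropy := by
  have := classEntropy_add_le h (inf_le_left : a ⊓ m ≤ a)
  rw [← inf_assoc, inf_eq_left.2 h] at this
  linarith

/-- If player `i` with knowledge `a i` receives the messages `m (q, i)`, then the total entropy
received is at least the total entropy sent, where the entropy sent by `q` is measured relatively
to the joint knowledge `b q` of all other players. -/
theorem sum_sub_refine_le {ι : Type*} [Fintype ι] [DecidableEq ι] (a b : ι → Setoid X)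
    (m : ι → ι → Setoid X) (hba : ∀ q i, i ≠ q → b q ≤ a i)
    (hbm : ∀ q q' i, q' ≠ q → i ≠ q → b q ≤ m q' i) (hm : ∀ q, m q q = ⊤) :
    ∑ q, ((b q).classEntropy - (b q ⊓ ⨅ i, m q i).classEntropy) ≤
      ∑ i, ((a i).classEntropy - (a i ⊓ ⨅ q, m q i).classEntropy) := by
  -- The messages are delivered one at a time: `A S` and `B S` are the two kinds of knowledge once
  -- those with (sender, receiver) in `S` have been taken into account.
  let A (S : Finset (ι × ι)) (i : ι) : Setoid X :=
    (a i).refine (fun p : ι × ι => m p.1 p.2) (S.filter fun p => p.2 = i)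
  let B (S : Finset (ι × ι)) (q : ι) : Setoid X :=
    (b q).refine (fun p : ι × ι => m p.1 p.2) (S.filter fun p => p.1 = q)
  have main : ∀ S : Finset (ι × ι),
      ∑ q, ((b q).classEntropy - (B S q).classEntropy) ≤
        ∑ i, ((a i).classEntropy - (A S i).classEntropy) := by
    intro S
    induction S using Finset.induction_on with
    | empty => simp [A, B, refine]
    | insert p S hp ih =>
      obtain ⟨q₀, i₀⟩ := p
      have hA : ∀ i, i ≠ i₀ → A (insert (q₀, i₀) S) i = A S i := fun i hi => by
        simp only [A]; rw [Finset.filter_insert, if_neg (by simpa using hi.symm)]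
      have hB : ∀ q, q ≠ q₀ → B (insert (q₀, i₀) S) q = B S q := fun q hq => by
        simp only [B]; rw [Finset.filter_insert, if_neg (by simpa using hq.symm)]
      have hA₀ : A (insert (q₀, i₀) S) i₀ = A S i₀ ⊓ m q₀ i₀ := by
        simp only [A]; rw [Finset.filter_insert, if_pos rfl, refine_insert]
      have hB₀ : B (insert (q₀, i₀) S) q₀ = B S q₀ ⊓ m q₀ i₀ := by
        simp only [B]; rw [Finset.filter_insert, if_pos rfl, refine_insert]
      have step : (B S q₀).classEntropy - (B S q₀ ⊓ m q₀ i₀).classEntropy ≤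
          (A S i₀).classEntropy - (A S i₀ ⊓ m q₀ i₀).classEntropy := by
        by_cases hi : i₀ = q₀
        · subst hi; simp [hm]
        -- `B S q₀` is finer than `A S i₀`: an earlier message to `i₀` comes either from `q₀`, and
        -- is part of `B S q₀`, or from another sender, and is already determined by `b q₀`.
        · refine classEntropy_sub_inf_le (le_inf (refine_le.trans (hba _ _ hi)) ?_) _
          refine le_iInf₂ fun p hpS => ?_
          obtain ⟨hpS', rfl⟩ := Finset.mem_filter.1 hpS
          by_cases hq : p.1 = q₀
          · exact refine_le_of_mem (m := fun p : ι × ι => m p.1 p.2)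
              (Finset.mem_filter.2 ⟨hpS', hq⟩)
          · exact refine_le.trans (hbm _ _ _ hq hi)
      rw [← Finset.add_sum_erase _ _ (Finset.mem_univ q₀),
        ← Finset.add_sum_erase _ (fun i => (a i).classEntropy - _) (Finset.mem_univ i₀),
        hA₀, hB₀,
        Finset.sum_congr rfl fun q hq => by rw [hB q (Finset.ne_of_mem_erase hq)],
        Finset.sum_congr (s₁ := Finset.univ.erase i₀) rfl fun i hi => by
          rw [hA i (Finset.ne_of_mem_erase hi)]]
      rw [← Finset.add_sum_erase _ _ (Finset.mem_univ q₀),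
        ← Finset.add_sum_erase _ (fun i => (a i).classEntropy - _) (Finset.mem_univ i₀)] at ih
      linarith
  have h := main Finset.univ
  have eA : ∀ i, A Finset.univ i = a i ⊓ ⨅ q, m q i := fun i => by
    simp only [A, refine]
    congr 1
    refine le_antisymm (le_iInf fun q => iInf₂_le (q, i) (by simp)) (le_iInf₂ fun p hp => ?_)
    obtain rfl := (Finset.mem_filter.1 hp).2
    exact iInf_le _ _
  have eB : ∀ q, B Finset.univ q = b q ⊓ ⨅ i, m q i := fun q => by
    simp only [B, refine]
    congr 1
    refine le_antisymm (le_iInf fun i => iInf₂_le (q, i) (by simp)) (le_iInf₂ fun p hp => ?_)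
    obtain rfl := (Finset.mem_filter.1 hp).2
    exact iInf_le _ _
  simpa only [eA, eB] using h

end Setoid

/-! ### Measurability of maps to discrete spaces -/

/-- All fibres of `f` are measurable. -/
def DiscreteMeasurable {S C : Type*} (m : MeasurableSpace S) (f : S → C) : Prop :=
  ∀ c, MeasurableSet[m] {s | f s = c}

namespace DiscreteMeasurable

variable {S C D : Type*} {m : MeasurableSpace S}

theorem const (c : C) : DiscreteMeasurable m fun _ : S => c := fun d => by
  by_cases h : c = d <;> simp [h]

/-- Each fibre is a countable union over the values of `f`. This handles executions, whose next step
depends on a random state with countably many values. -/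
theorem bind [Countable C] {f : S → C} (hf : DiscreteMeasurable m f) {g : C → S → D}
    (hg : ∀ c, DiscreteMeasurable m (g c)) : DiscreteMeasurable m fun s => g (f s) s := by
  intro d
  have : {s | g (f s) s = d} = ⋃ c, {s | f s = c} ∩ {s | g c s = d} := by
    ext s; simp
  rw [this]
  exact MeasurableSet.iUnion fun c => (hf c).inter (hg c d)

theorem map [Countable C] {f : S → C} (hf : DiscreteMeasurable m f) (g : C → D) :
    DiscreteMeasurable m fun s => g (f s) :=
  hf.bind fun c => const (g c)

theorem prodMk {f : S → C} (hf : DiscreteMeasurable m f) {g : S → D}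
    (hg : DiscreteMeasurable m g) : DiscreteMeasurable m fun s => (f s, g s) := fun c => by
  have : {s | (f s, g s) = c} = {s | f s = c.1} ∩ {s | g s = c.2} := by
    ext s; simp [Prod.ext_iff]
  rw [this]
  exact (hf _).inter (hg _)

theorem pi {ι : Type*} [Countable ι] {C : ι → Type*} {f : ∀ i, S → C i}
    (hf : ∀ i, DiscreteMeasurable m (f i)) : DiscreteMeasurable m fun s i => f i s := fun c => by
  have : {s | (fun i => f i s) = c} = ⋂ i, {s | f i s = c i} := by
    ext s; simp [funext_iff]
  rw [this]
  exact MeasurableSet.iInter fun i => hf i _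

theorem comp {T : Type*} {m' : MeasurableSpace T} {f : S → C} (hf : DiscreteMeasurable m f)
    {g : T → S} (hg : Measurable g) : DiscreteMeasurable m' fun t => f (g t) :=
  fun c => hg (hf c)

theorem measurable [Countable C] [MeasurableSpace C] {f : S → C}
    (hf : DiscreteMeasurable m f) : Measurable f := fun B _ => by
  have : f ⁻¹' B = ⋃ c : B, {s | f s = c} := by
    ext s; simp
  rw [this]
  exact MeasurableSet.iUnion fun c => hf c

end DiscreteMeasurable

theorem Measurable.discreteMeasurable {S C : Type*} {m : MeasurableSpace S} [MeasurableSpace C]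
    [MeasurableSingletonClass C] {f : S → C} (hf : Measurable f) : DiscreteMeasurable m f :=
  fun c => hf (measurableSet_singleton c)

/-! ### Conditional entropy for uniform inputs -/

open Classical in
/-- The equivalence class of `x`. -/
def Setoid.classFinset {X : Type*} [Fintype X] (s : Setoid X) (x : X) : Finset X :=
  Finset.univ.filter fun y => s x y

section Class

variable {X : Type*} [Fintype X]

open Classical in
-- Double counting of related pairs inside a union `B` of classes. It is the defining property of a
-- conditional probability: averaging the proportion of `p` in the class of `x` over `B` gives the
-- measure of `B ∩ p`.
theorem Setoid.sum_card_div_classCard (s : Setoid X) (B p : X → Prop)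
    (hB : ∀ x y, s x y → B x → B y) :
    ∑ x, (if B x then (((s.classFinset x).filter p).card : ℝ) / s.classCard x else 0) =
      ∑ x, if B x ∧ p x then 1 else 0 := by
  have h1 : ∀ x, (if B x then (((s.classFinset x).filter p).card : ℝ) / s.classCard x else 0) =
      ∑ y, if s y x then (if B y ∧ p y then (s.classCard y : ℝ)⁻¹ else 0) else 0 := by
    intro x
    by_cases hx : B x
    · rw [if_pos hx, div_eq_mul_inv, Setoid.classFinset, Finset.filter_filter,
        Finset.card_filter, Nat.cast_sum, Finset.sum_mul]
      refine Finset.sum_congr rfl fun y _ => ?_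
      by_cases hy : s x y
      · have := hB x y hy hx
        simp only [hy, s.symm hy, this, true_and, if_true, s.classCard_eq_of_rel hy]
        split_ifs <;> simp
      · have : ¬ s y x := fun h => hy (s.symm h)
        simp [hy, this]
    · rw [if_neg hx]
      refine (Finset.sum_eq_zero fun y _ => ?_).symm
      by_cases hy : s y x
      · have : ¬ B y := fun h => hx (hB _ _ hy h)
        simp [this]
      · simp [hy]
  simp_rw [h1]
  rw [Finset.sum_comm]
  refine Finset.sum_congr rfl fun y _ => ?_
  rw [← Finset.sum_filter, Finset.sum_const, nsmul_eq_mul]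
  split_ifs
  · exact mul_inv_cancel₀ (by exact_mod_cast (s.classCard_pos y).ne')
  · simp

open Classical in
-- As `Y` is injective on the class, it is uniform on as many values as the class has elements.
theorem Setoid.sum_negMulLog_eq_logb {A : Type*} [Fintype A] (s : Setoid X) (Y : X → A)
    (hY : ∀ x y, s x y → Y x = Y y → x = y) (x : X) :
    ∑ a, Real.negMulLog ((((s.classFinset x).filter fun y => Y y = a).card : ℝ)
      / s.classCard x) / Real.log 2 = Real.logb 2 (s.classCard x) := by
  have hinj : Set.InjOn Y (s.classFinset x) := by
    intro y hy z hz h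
    simp only [Setoid.classFinset, Finset.coe_filter, Finset.mem_univ, true_and,
      Set.mem_ofPred_eq] at hy hz
    exact hY y z (s.trans (s.symm hy) hz) h
  have hpos : (0 : ℝ) < s.classCard x := by exact_mod_cast s.classCard_pos x
  have hval : ∀ a, Real.negMulLog ((((s.classFinset x).filter fun y => Y y = a).card : ℝ)
      / s.classCard x) =
      if a ∈ (s.classFinset x).image Y then Real.log (s.classCard x) / s.classCard x else 0 := by
    intro a
    split_ifs with ha
    · obtain ⟨y, hy, rfl⟩ := Finset.mem_image.1 ha
      have : (s.classFinset x).filter (fun z => Y z = Y y) = {y} := by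
        ext z
        simp only [Finset.mem_filter, Finset.mem_singleton]
        exact ⟨fun h => hinj h.1 hy h.2, fun h => by subst h; exact ⟨hy, rfl⟩⟩
      rw [this]
      simp [Real.negMulLog]
      ring
    · have : (s.classFinset x).filter (fun z => Y z = a) = ∅ :=
        Finset.filter_eq_empty_iff.2 fun z hz h => ha (Finset.mem_image.2 ⟨z, hz, h⟩)
      simp [this]
  simp_rw [hval]
  rw [← Finset.sum_div, ← Finset.sum_filter, Finset.sum_const, nsmul_eq_mul,
    Finset.filter_mem_eq_inter, Finset.univ_inter, Finset.card_image_of_injOn hinj]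
  have : (s.classFinset x).card = s.classCard x := rfl
  rw [this, mul_div_cancel₀ _ hpos.ne', Real.logb]

end Class

/-! ### Conditional entropy as a mean of class entropies -/

section Uniform

variable {X Ω : Type*} [Fintype X] [MeasurableSpace X] [DiscreteMeasurableSpace X]
  [MeasurableSpace Ω] (ν : Measure Ω) [IsProbabilityMeasure ν]

instance [Nonempty X] : IsProbabilityMeasure (uniformOn (Set.univ : Set X)) :=
  isProbabilityMeasure_uniformOn Set.finite_univ Set.univ_nonempty

theorem integral_uniformOn_univ (f : X → ℝ) :
    ∫ x, f x ∂uniformOn (Set.univ : Set X) = (Fintype.card X : ℝ)⁻¹ * ∑ x, f x := by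
  rw [uniformOn, ProbabilityTheory.cond, Measure.restrict_univ, integral_smul_measure,
    integral_count, Measure.count_univ]
  simp

theorem integral_uniformOn_prod {f : X × Ω → ℝ}
    (hf : Integrable f ((uniformOn (Set.univ : Set X)).prod ν)) :
    ∫ p, f p ∂(uniformOn (Set.univ : Set X)).prod ν =
      (Fintype.card X : ℝ)⁻¹ * ∫ r, ∑ x, f (x, r) ∂ν := by
  rw [integral_prod_symm f hf, ← integral_const_mul]
  simp_rw [integral_uniformOn_univ]

open Classical in
/-- Let `x` be uniform and independent of `r`. If the information `G` determines `r` and exactly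
the class of `x` for the relation `s r`, and `Y x` determines `x` within its class, then the
conditional entropy of `Y x` given `G` is the mean logarithm of the size of the class. -/
theorem condEntropy_comap_uniformOn_prod {A E : Type*} [Fintype A] [MeasurableSpace E]
    {G : X × Ω → E} (hG : Measurable G) (s : Ω → Setoid X) (Y : X → A)
    (hs : ∀ r x y, s r x y → G (x, r) = G (y, r))
    (hcl : DiscreteMeasurable (MeasurableSpace.comap G inferInstance)
      fun p : X × Ω => (s p.2).classFinset p.1)
    (hY : ∀ r x y, s r x y → Y x = Y y → x = y) :
    Integrable (fun r => (s r).classEntropy) ν ∧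
      condEntropy (MeasurableSpace.comap G inferInstance)
        ((uniformOn (Set.univ : Set X)).prod ν) (fun p => Y p.1) =
        (Fintype.card X : ℝ)⁻¹ * ∫ r, (s r).classEntropy ∂ν := by
  set μ := (uniformOn (Set.univ : Set X)).prod ν with hμ
  have hm : MeasurableSpace.comap G inferInstance ≤
      (inferInstance : MeasurableSpace (X × Ω)) := hG.comap_le
  -- The candidate for the conditional probability of `Y = a`: its proportion in the current class.
  let f (a : A) (p : X × Ω) : ℝ :=
    ((((s p.2).classFinset p.1).filter fun y => Y y = a).card : ℝ) / (s p.2).classCard p.1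
  have hcl' : DiscreteMeasurable inferInstance
      fun p : X × Ω => (s p.2).classFinset p.1 := fun c => hm _ (hcl c)
  have hfm : ∀ a, Measurable[MeasurableSpace.comap G inferInstance] (f a) := fun a => by
    have h : Measurable[MeasurableSpace.comap G inferInstance, ⊤]
        fun p : X × Ω => (s p.2).classFinset p.1 :=
      @DiscreteMeasurable.measurable _ _ _ _ ⊤ _ hcl
    exact (@measurable_from_top _ _ _ fun c : Finset X =>
      ((c.filter fun y => Y y = a).card : ℝ) / c.card).comp h
  have hf0 : ∀ a p, 0 ≤ f a p := fun a p => by positivity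
  have hf1 : ∀ a p, f a p ≤ 1 := fun a p => by
    refine div_le_one_of_le₀ ?_ (by positivity)
    exact_mod_cast Finset.card_le_card (Finset.filter_subset _ _)
  have hfi : ∀ a, Integrable (f a) μ := fun a =>
    Integrable.of_bound ((hfm a).mono hm le_rfl).aestronglyMeasurable 1
      (Filter.Eventually.of_forall fun p => by
        rw [Real.norm_of_nonneg (hf0 a p)]; exact hf1 a p)
  have hYm : ∀ a, MeasurableSet ((fun p : X × Ω => Y p.1) ⁻¹' {a}) := fun a =>
    measurable_fst (MeasurableSet.of_discrete (s := {x | Y x = a}))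
  have hce : ∀ a, f a =ᵐ[μ]
      μ⟦(fun p : X × Ω => Y p.1) ⁻¹' {a} | MeasurableSpace.comap G inferInstance⟧ := by
    intro a
    refine ae_eq_condExp_of_forall_setIntegral_eq hm
      ((integrable_const _).indicator (hYm a)) (fun _ _ _ => (hfi a).integrableOn) ?_
      (hfm a).aestronglyMeasurable
    intro B hB _
    have hB' := hm _ hB
    rw [← integral_indicator hB', ← integral_indicator hB',
      integral_uniformOn_prod ν ((hfi a).indicator hB'),
      integral_uniformOn_prod ν (((integrable_const _).indicator (hYm a)).indicator hB')]
    congr 2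
    ext r
    -- An event `B` determined by `G` has, for fixed `r`, a slice that is a union of classes.
    have := (s r).sum_card_div_classCard (fun x => (x, r) ∈ B) (fun x => Y x = a)
      (fun x y hxy hx => by
        obtain ⟨T, -, rfl⟩ := hB
        simpa only [Set.mem_preimage, hs r x y hxy] using hx)
    simp only [Set.indicator_apply, f]
    rw [this]
    refine Finset.sum_congr rfl fun x _ => ?_
    by_cases h1 : (x, r) ∈ B <;> simp [h1]
  have hint : ∀ p : X × Ω, ∑ a, Real.negMulLog (f a p) / Real.log 2 =
      Real.logb 2 ((s p.2).classCard p.1) := fun p =>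
    (s p.2).sum_negMulLog_eq_logb Y (hY p.2) p.1
  have hlm : Measurable fun p : X × Ω => Real.logb 2 ((s p.2).classCard p.1) := by
    have h : Measurable[_, ⊤] fun p : X × Ω => (s p.2).classFinset p.1 :=
      @DiscreteMeasurable.measurable _ _ _ _ ⊤ _ hcl'
    exact (@measurable_from_top _ _ _ fun c : Finset X => Real.logb 2 c.card).comp h
  have hl0 : ∀ (r : Ω) x, 0 ≤ Real.logb 2 ((s r).classCard x) := fun r x =>
    Real.logb_nonneg (by norm_num) (by exact_mod_cast (s r).classCard_pos x)
  have hl1 : ∀ (r : Ω) x, Real.logb 2 ((s r).classCard x) ≤ Real.logb 2 (Fintype.card X) :=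
    fun r x => Real.logb_le_logb_of_le (by norm_num)
      (by exact_mod_cast (s r).classCard_pos x) (by exact_mod_cast (s r).classCard_le_card x)
  have hli : Integrable (fun p : X × Ω => Real.logb 2 ((s p.2).classCard p.1)) μ :=
    Integrable.of_bound hlm.aestronglyMeasurable (Real.logb 2 (Fintype.card X))
      (Filter.Eventually.of_forall fun p => by
        rw [Real.norm_of_nonneg (hl0 _ _)]; exact hl1 _ _)
  refine ⟨?_, ?_⟩
  · refine integrable_finsetSum _ fun x _ => Integrable.of_bound
      (hlm.comp (measurable_prodMk_left (x := x))).aestronglyMeasurable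
      (Real.logb 2 (Fintype.card X)) (Filter.Eventually.of_forall fun r => ?_)
    change ‖Real.logb 2 ((s r).classCard x)‖ ≤ _
    rw [Real.norm_of_nonneg (hl0 _ _)]
    exact hl1 _ _
  · have hae : ∀ᵐ p ∂μ, ∀ a, f a p =
        (μ⟦(fun p : X × Ω => Y p.1) ⁻¹' {a} | MeasurableSpace.comap G inferInstance⟧) p :=
      ae_all_iff.2 hce
    refine Eq.trans (integral_congr_ae ?_) (integral_uniformOn_prod ν hli)
    filter_upwards [hae] with p hp
    rw [← hint p]
    exact Finset.sum_congr rfl fun a _ => by rw [hp a]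

end Uniform

/-! ### Histories -/

namespace History

variable {k : ℕ}

/-- The senders of the messages read in each local round. -/
def shape (h : History k) : List (Fin k → Bool) := h.map fun e q => (e q).isSome

theorem length_eq_of_shape_eq {h h' : History k} (hs : shape h = shape h') :
    h.length = h'.length := by
  simpa [shape] using congrArg List.length hs

theorem countP_eq_of_shape_eq {h h' : History k} (hs : shape h = shape h') (q : Fin k) :
    (h.countP fun e => (e q).isSome) = h'.countP fun e => (e q).isSome := by
  have : ∀ l : History k, (l.countP fun e => (e q).isSome) = (shape l).countP fun e => e q := by
    intro l; simp [shape, List.countP_map, Function.comp_def]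
  rw [this, this, hs]

end History

/-- `filterMap` forgets only the positions of the entries `none`, and these are assumed to agree. -/
theorem List.eq_of_filterMap_eq {γ δ : Type*} {e e' : γ → Option δ} (l : List γ)
    (hs : ∀ q ∈ l, (e q).isSome = (e' q).isSome) (h : l.filterMap e = l.filterMap e') :
    ∀ q ∈ l, e q = e' q := by
  induction l with
  | nil => simp
  | cons a l ih =>
    have ha := hs a (by simp)
    have hl : ∀ q ∈ l, (e q).isSome = (e' q).isSome := fun q hq => hs q (by simp [hq])
    rcases h1 : e a with _ | b <;> rcases h2 : e' a with _ | b' <;> simp [h1, h2] at ha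
    · simp only [List.filterMap_cons, h1, h2] at h
      simpa [h1, h2] using ih hl h
    · simp only [List.filterMap_cons, h1, h2, List.cons.injEq] at h
      simpa [h1, h2, h.1] using ih hl h.2

theorem List.length_filterMap_eq_of_isSome_eq {γ δ : Type*} {e e' : γ → Option δ} (l : List γ)
    (hs : ∀ q ∈ l, (e q).isSome = (e' q).isSome) :
    (l.filterMap e).length = (l.filterMap e').length := by
  rw [List.length_filterMap_eq_countP, List.length_filterMap_eq_countP]
  exact List.countP_congr fun q hq => by rw [hs q hq]

/-! ### Histories, transcripts and runs -/

namespace Protocol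

variable {k : ℕ}

theorem messagesRead_cons (e : Fin k → Option (List Bool)) (h : History k) :
    messagesRead (e :: h) = (List.finRange k).filterMap e ++ messagesRead h := rfl

theorem messagesRead_append (h h' : History k) :
    messagesRead (h ++ h') = messagesRead h ++ messagesRead h' := by
  simp [messagesRead]

/-- The shape says how to cut the flat list of messages into rounds and senders. This is why the
transcript of an oblivious protocol loses nothing, even without self-delimiting messages. -/
theorem eq_of_messagesRead_eq {h h' : History k} (hs : h.shape = h'.shape)
    (hm : messagesRead h = messagesRead h') : h = h' := by
  induction h generalizing h' with
  | nil =>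
    have := History.length_eq_of_shape_eq hs
    exact (List.length_eq_zero_iff.1 this.symm).symm
  | cons e h ih =>
    cases h' with
    | nil => simpa using History.length_eq_of_shape_eq hs
    | cons e' h' =>
      simp only [History.shape, List.map_cons, List.cons.injEq] at hs
      have he : ∀ q, (e q).isSome = (e' q).isSome := congrFun hs.1
      rw [messagesRead_cons, messagesRead_cons] at hm
      obtain ⟨h1, h2⟩ := List.append_inj hm
        (List.length_filterMap_eq_of_isSome_eq _ fun q _ => he q)
      rw [ih hs.2 h2]
      congr 1
      funext q
      exact List.eq_of_filterMap_eq _ (fun q _ => he q) h1 q (List.mem_finRange q)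

theorem length_messagesRead (h : History k) :
    (messagesRead h).length = ∑ q, h.countP fun e => (e q).isSome := by
  induction h with
  | nil => simp [messagesRead]
  | cons e h ih =>
    have : ((List.finRange k).filterMap e).length = ∑ q, if (e q).isSome then 1 else 0 := by
      rw [List.length_filterMap_eq_countP, Fin.sum_univ_def]
      generalize List.finRange k = l
      induction l with
      | nil => rfl
      | cons a l ih => simp [List.countP_cons, ih, add_comm]
    simp only [messagesRead_cons, List.length_append, ih, this, List.countP_cons,
      Finset.sum_add_distrib]
    rw [add_comm]

variable {α : Type*} {Ω : Fin k → Type*} {P β : Type*}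
  [∀ i, MeasurableSpace (Ω i)] [MeasurableSpace P] (π : Protocol k α Ω P β)

/-- All messages that player `i` waits for have arrived. -/
def Ready (x : Fin k → α) (r : (∀ i, Ω i) × P) (H : Fin k → History k) (i : Fin k) : Prop :=
  ∀ q ∈ π.waitFor i (view x r i (H i)), (π.nextMessage x r H q i).isSome

open Classical in
/-- The message from player `q` that player `i` reads when it completes its local round. -/
def received (x : Fin k → α) (r : (∀ i, Ω i) × P) (H : Fin k → History k) (i q : Fin k) :
    Option (List Bool) :=
  if q ∈ π.waitFor i (view x r i (H i)) then π.nextMessage x r H q i else none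

variable {π}

theorem advance_of_ready {x : Fin k → α} {r : (∀ i, Ω i) × P} {H : Fin k → History k} {i : Fin k}
    (h : π.Ready x r H i) : π.advance x r H i = H i ++ [π.received x r H i] := by
  unfold Ready at h
  rw [advance, if_pos h]
  rfl

theorem advance_of_not_ready {x : Fin k → α} {r : (∀ i, Ω i) × P} {H : Fin k → History k}
    {i : Fin k} (h : ¬ π.Ready x r H i) : π.advance x r H i = H i := by
  unfold Ready at h
  rw [advance, if_neg h]

theorem run_prefix_succ (x : Fin k → α) (r : (∀ i, Ω i) × P) (t : ℕ) (i : Fin k) :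
    π.run x r t i <+: π.run x r (t + 1) i := by
  rw [run]
  by_cases h : π.Ready x r (π.run x r t) i
  · rw [advance_of_ready h]; exact List.prefix_append _ _
  · rw [advance_of_not_ready h]

theorem run_prefix (x : Fin k → α) (r : (∀ i, Ω i) × P) {s t : ℕ} (h : s ≤ t) (i : Fin k) :
    π.run x r s i <+: π.run x r t i := by
  induction t, h using Nat.le_induction with
  | base => exact List.prefix_rfl
  | succ t _ ih => exact ih.trans (run_prefix_succ x r t i)

theorem messagesRead_run_prefix (x : Fin k → α) (r : (∀ i, Ω i) × P) {s t : ℕ} (h : s ≤ t)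
    (i : Fin k) : messagesRead (π.run x r s i) <+: messagesRead (π.run x r t i) := by
  obtain ⟨l, hl⟩ := π.run_prefix x r h i
  rw [← hl, messagesRead_append]
  exact List.prefix_append _ _

theorem received_self (x : Fin k → α) (r : (∀ i, Ω i) × P) (H : Fin k → History k) (i : Fin k) :
    π.received x r H i i = none :=
  if_neg (π.notMem_waitFor i _)

omit [∀ i, MeasurableSpace (Ω i)] [MeasurableSpace P] in
theorem view_congr {x y : Fin k → α} {i : Fin k} (h : x i = y i) (r : (∀ i, Ω i) × P)
    (l : History k) : view x r i l = view y r i l := by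
  rw [view, view, h]

theorem sent_congr {x y : Fin k → α} {q : Fin k} (h : x q = y q) (r : (∀ i, Ω i) × P)
    (i : Fin k) (l : History k) : π.sent x r q i l = π.sent y r q i l := by
  unfold sent
  simp only [view_congr h]

theorem received_congr {x y : Fin k → α} {H H' : Fin k → History k} {q i : Fin k}
    (hq : x q = y q) (hi : x i = y i) (r : (∀ i, Ω i) × P) (hHq : H q = H' q) (hHi : H i = H' i) :
    π.received x r H i q = π.received y r H' i q := by
  unfold received nextMessage
  rw [sent_congr hq, view_congr hi, hHq, hHi]

/-! ### Oblivious protocols -/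

section Oblivious

variable (ho : π.Oblivious)
include ho

theorem Oblivious.sendTo_eq (i : Fin k) {v w : View k α (Ω i) P}
    (h : v.received.length = w.received.length) : π.sendTo i v = π.sendTo i w := by
  obtain ⟨S, W, h'⟩ := ho
  rw [(h' i v).1, (h' i w).1, h]

theorem Oblivious.waitFor_eq (i : Fin k) {v w : View k α (Ω i) P}
    (h : v.received.length = w.received.length) : π.waitFor i v = π.waitFor i w := by
  obtain ⟨S, W, h'⟩ := ho
  rw [(h' i v).2, (h' i w).2, h]

theorem Oblivious.length_sent_eq (x y : Fin k → α) (r r' : (∀ i, Ω i) × P) (q i : Fin k)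
    {h h' : History k} (hl : h.length = h'.length) :
    (π.sent x r q i h).length = (π.sent y r' q i h').length := by
  unfold sent
  rw [hl]
  refine List.length_filterMap_eq_of_isSome_eq _ fun j _ => ?_
  rw [ho.sendTo_eq q (v := view x r q (h.take j)) (w := view y r' q (h'.take j))
    (by simp [view, hl])]
  split_ifs <;> rfl

theorem Oblivious.length_sent_le (x : Fin k → α) (r : (∀ i, Ω i) × P) (q i : Fin k)
    {h h' : History k} (hl : h <+: h') :
    (π.sent x r q i h).length ≤ (π.sent x r q i h').length := by
  unfold sent
  rw [List.length_filterMap_eq_countP, List.length_filterMap_eq_countP]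
  have hle := hl.length_le
  refine le_trans (le_of_eq (List.countP_congr fun j hj => ?_))
    ((List.range_sublist.2 (Nat.add_le_add_right hle 1)).countP_le)
  have hj : j ≤ h.length := Nat.lt_succ_iff.1 (List.mem_range.1 hj)
  rw [ho.sendTo_eq q (v := view x r q (h.take j)) (w := view x r q (h'.take j))
    (by simp [view, hj, hj.trans hle])]
  split_ifs <;> rfl

theorem Oblivious.isSome_nextMessage (x y : Fin k → α) (r r' : (∀ i, Ω i) × P)
    {H H' : Fin k → History k} (hH : ∀ i, (H i).shape = (H' i).shape) (q i : Fin k) :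
    (π.nextMessage x r H q i).isSome = (π.nextMessage y r' H' q i).isSome := by
  unfold nextMessage
  rw [Bool.eq_iff_iff, isSome_getElem?, isSome_getElem?,
    History.countP_eq_of_shape_eq (hH i),
    ho.length_sent_eq x y r r' q i (History.length_eq_of_shape_eq (hH q))]

theorem Oblivious.ready_iff (x y : Fin k → α) (r r' : (∀ i, Ω i) × P)
    {H H' : Fin k → History k} (hH : ∀ i, (H i).shape = (H' i).shape) (i : Fin k) :
    π.Ready x r H i ↔ π.Ready y r' H' i := by
  unfold Ready
  rw [ho.waitFor_eq i (v := view x r i (H i)) (w := view y r' i (H' i))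
    (History.length_eq_of_shape_eq (hH i))]
  simp only [ho.isSome_nextMessage x y r r' hH]

/-- Whether a player can proceed depends only on counts of sent and read messages, which
obliviousness fixes given the shapes so far. -/
theorem Oblivious.shape_run_eq (x y : Fin k → α) (r r' : (∀ i, Ω i) × P) (t : ℕ) (i : Fin k) :
    (π.run x r t i).shape = (π.run y r' t i).shape := by
  induction t generalizing i with
  | zero => rfl
  | succ t ih =>
    have hr := ho.ready_iff x y r r' ih i
    by_cases h : π.Ready x r (π.run x r t) i
    · rw [run, run, advance_of_ready h, advance_of_ready (hr.1 h)]
      have := ih i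
      simp only [History.shape, List.map_append, List.map_cons, List.map_nil] at this ⊢
      rw [this]
      congr 2
      funext q
      unfold received
      rw [ho.waitFor_eq i (v := view x r i (π.run x r t i)) (w := view y r' i (π.run y r' t i))
        (History.length_eq_of_shape_eq (ih i))]
      split_ifs
      · exact ho.isSome_nextMessage x y r r' ih q i
      · rfl
    · rw [run, run, advance_of_not_ready h, advance_of_not_ready fun h' => h (hr.2 h'), ih]

theorem Oblivious.ready_run_iff (x y : Fin k → α) (r r' : (∀ i, Ω i) × P) (t : ℕ) (i : Fin k) :
    π.Ready x r (π.run x r t) i ↔ π.Ready y r' (π.run y r' t) i :=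
  ho.ready_iff x y r r' (fun i => ho.shape_run_eq x y r r' t i) i

theorem Oblivious.length_messagesRead_run_eq (x y : Fin k → α) (r r' : (∀ i, Ω i) × P) (t : ℕ)
    (i : Fin k) :
    (messagesRead (π.run x r t i)).length = (messagesRead (π.run y r' t i)).length := by
  rw [length_messagesRead, length_messagesRead]
  exact Finset.sum_congr rfl fun q _ =>
    History.countP_eq_of_shape_eq (ho.shape_run_eq x y r r' t i) q

theorem Oblivious.countP_run_le (x : Fin k → α) (r : (∀ i, Ω i) × P) (t : ℕ) (q i : Fin k) :
    ((π.run x r t i).countP fun e => (e q).isSome) ≤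
      (π.sent x r q i (π.run x r t q)).length := by
  induction t with
  | zero => simp [run]
  | succ t ih =>
    refine le_trans ?_ (ho.length_sent_le x r q i (run_prefix_succ x r t q))
    by_cases h : π.Ready x r (π.run x r t) i
    · rw [run, advance_of_ready h, List.countP_append]
      unfold received
      by_cases hq : q ∈ π.waitFor i (view x r i (π.run x r t i))
      · have := h q hq
        have h' := this
        rw [nextMessage, isSome_getElem?] at h'
        simp only [List.countP_cons, if_pos hq, this]
        simpa using h'
      · simpa [hq] using ih
    · rw [run, advance_of_not_ready h]
      exact ih

theorem Oblivious.run_eq_of_run_eq {x y : Fin k → α} {r : (∀ i, Ω i) × P} {s t : ℕ}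
    (hst : s ≤ t) {i : Fin k} (h : π.run x r t i = π.run y r t i) :
    π.run x r s i = π.run y r s i := by
  have hx := run_prefix (π := π) x r hst i
  have hy := run_prefix (π := π) y r hst i
  rw [List.prefix_iff_eq_take.1 hx, List.prefix_iff_eq_take.1 hy, h,
    History.length_eq_of_shape_eq (ho.shape_run_eq x y r r s i)]

/-- The number of messages read by time `t` is the same for all inputs and tapes. In one reference
execution it is nondecreasing and bounded by the number of messages sent, hence eventually constant;
so a single `T` works for every execution, even with infinitely many tapes. -/
theorem Oblivious.exists_transcript_eq [Nonempty (Fin k → α)] [Nonempty ((∀ i, Ω i) × P)]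
    (hs : π.Stops) :
    ∃ T, ∀ t, T ≤ t → ∀ x r i, π.transcript x r i = messagesRead (π.run x r t i) := by
  obtain ⟨x₀⟩ := ‹Nonempty (Fin k → α)›
  obtain ⟨r₀⟩ := ‹Nonempty ((∀ i, Ω i) × P)›
  obtain ⟨T₀, hT₀⟩ := hs x₀ r₀
  let f (i : Fin k) (t : ℕ) : ℕ := (messagesRead (π.run x₀ r₀ t i)).length
  have hf : ∀ i, Monotone (f i) := fun i s t hst =>
    (messagesRead_run_prefix x₀ r₀ hst i).length_le
  have hbound : ∀ i, ∃ C, ∀ t, f i t ≤ C := by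
    intro i
    refine ⟨∑ q, (π.sent x₀ r₀ q i (π.run x₀ r₀ T₀ q)).length, fun t => ?_⟩
    refine (hf i (le_max_left t T₀)).trans ?_
    simp only [f, length_messagesRead]
    refine Finset.sum_le_sum fun q _ => (ho.countP_run_le x₀ r₀ _ q i).trans ?_
    rw [hT₀ _ (le_max_right t T₀)]
  have hconst : ∀ i, ∃ T, ∀ t, T ≤ t → f i t = f i T := by
    intro i
    obtain ⟨C, hC⟩ := hbound i
    -- Minimizing the slack `C - f i t` picks a time at which the bounded monotone `f i` attains its
    -- maximum.
    refine ⟨Function.argmin fun t => C - f i t, fun t ht => ?_⟩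
    have h1 := Function.argmin_le (fun t => C - f i t) t
    have h2 := hf i ht
    have h3 := hC t
    omega
  choose T hT using hconst
  have hle : ∀ i, T i ≤ ∑ i, T i := fun i => Finset.single_le_sum (fun _ _ => Nat.zero_le _)
    (Finset.mem_univ i)
  have hrun : ∀ t, ∑ i, T i ≤ t → ∀ x r i,
      messagesRead (π.run x r t i) = messagesRead (π.run x r (∑ i, T i) i) := by
    intro t ht x r i
    refine ((messagesRead_run_prefix x r ht i).eq_of_length ?_).symm
    rw [ho.length_messagesRead_run_eq x x₀ r r₀, ho.length_messagesRead_run_eq x x₀ r r₀]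
    exact (hT i _ (hle i)).trans (hT i _ ((hle i).trans ht)).symm
  refine ⟨∑ i, T i, fun t ht x r i => ?_⟩
  have hex : ∃ l, ∀ᶠ t in Filter.atTop, messagesRead (π.run x r t i) = l :=
    ⟨_, Filter.eventually_atTop.2 ⟨∑ i, T i, fun t ht => hrun t ht x r i⟩⟩
  rw [transcript, dif_pos hex]
  obtain ⟨s, hs1, hs2⟩ := (hex.choose_spec.and (Filter.eventually_ge_atTop (∑ i, T i))).exists
  rw [← hs1, hrun s hs2, hrun t ht]

end Oblivious

/-! ### Measurability -/

variable (π)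

theorem discreteMeasurable_local {i : Fin k} {C : Type*} {f : View k α (Ω i) P → C}
    (hf : ∀ a h c, MeasurableSet {r : Ω i × P | f ⟨a, r.1, r.2, h⟩ = c}) (x : Fin k → α)
    (h : History k) :
    DiscreteMeasurable inferInstance fun r : (∀ i, Ω i) × P => f (view x r i h) :=
  DiscreteMeasurable.comp (S := Ω i × P) (f := fun r => f ⟨x i, r.1, r.2, h⟩) (hf (x i) h)
    (((measurable_pi_apply i).comp measurable_fst).prodMk measurable_snd)

theorem discreteMeasurable_sent (x : Fin k → α) (q i : Fin k) (h : History k) :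
    DiscreteMeasurable inferInstance fun r => π.sent x r q i h := by
  unfold sent
  generalize List.range (h.length + 1) = l
  induction l with
  | nil => exact DiscreteMeasurable.const []
  | cons j l ih =>
    have h1 := discreteMeasurable_local (fun a h => π.measurable_sendTo q a h) x (h.take j)
    have h2 := discreteMeasurable_local (f := fun v => π.message q v i)
      (fun a h => π.measurable_message q a h i) x (h.take j)
    convert ((h1.prodMk h2).prodMk ih).map
      (fun c => if i ∈ c.1.1 then c.1.2 :: c.2 else c.2) using 2 with r
    rw [List.filterMap_cons]
    split_ifs <;> rfl

open Classical in
theorem discreteMeasurable_advance (x : Fin k → α) (H : Fin k → History k) :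
    DiscreteMeasurable inferInstance fun r => π.advance x r H := by
  refine DiscreteMeasurable.pi fun i => ?_
  have h1 := discreteMeasurable_local (fun a h => π.measurable_waitFor i a h) x (H i)
  have h2 : DiscreteMeasurable inferInstance
      fun (r : (∀ i, Ω i) × P) q => π.nextMessage x r H q i :=
    DiscreteMeasurable.pi fun q => (π.discreteMeasurable_sent x q i (H q)).map
      fun l : List (List Bool) => l[(H i).countP fun e : Fin k → Option (List Bool) => (e q).isSome]?
  convert (h1.prodMk h2).map (fun c => if ∀ q ∈ c.1, (c.2 q).isSome then
    H i ++ [fun q => if q ∈ c.1 then c.2 q else none] else H i) using 2 with r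
  rw [advance]

theorem discreteMeasurable_run (x : Fin k → α) (t : ℕ) :
    DiscreteMeasurable inferInstance fun r => π.run x r t := by
  induction t with
  | zero => exact DiscreteMeasurable.const _
  | succ t ih => exact ih.bind fun H => π.discreteMeasurable_advance x H

variable {π}

theorem Oblivious.discreteMeasurable_transcript (ho : π.Oblivious) [Nonempty (Fin k → α)]
    [Nonempty ((∀ i, Ω i) × P)] (hs : π.Stops) (x : Fin k → α) (i : Fin k) :
    DiscreteMeasurable inferInstance fun r => π.transcript x r i := by
  obtain ⟨T, hT⟩ := ho.exists_transcript_eq hs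
  simp only [hT T le_rfl]
  exact (π.discreteMeasurable_run x T).map fun H => messagesRead (H i)

end Protocol

/-! ### The public information cost as an average of class entropies -/

theorem Setoid.classCard_ker_apply {k : ℕ} {α : Type*} [Fintype α] (i : Fin k)
    (x : Fin k → α) :
    (Setoid.ker fun x : Fin k → α => x i).classCard x = Fintype.card α ^ (k - 1) := by
  classical
  have : (Finset.univ.filter fun y => Setoid.ker (fun x : Fin k → α => x i) x y) =
      Fintype.piFinset fun q => if q = i then {x i} else Finset.univ := by
    ext y
    simp only [Finset.mem_filter, Finset.mem_univ, true_and, Setoid.ker_def,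
      Fintype.mem_piFinset]
    refine ⟨fun h q => ?_, fun h => ?_⟩
    · split_ifs with hq
      · subst hq; simp [h]
      · simp
    · have : y i = x i := by simpa using h i
      exact this.symm
  rw [Setoid.classCard, this, Fintype.card_piFinset, ← Finset.mul_prod_erase _ _ (Finset.mem_univ i),
    Finset.prod_congr rfl fun q hq => by rw [if_neg (Finset.ne_of_mem_erase hq)]]
  simp

theorem Setoid.classCard_ker_others {k : ℕ} {α : Type*} [Fintype α] (q : Fin k)
    (x : Fin k → α) :
    (Setoid.ker fun (x : Fin k → α) (i : {i // i ≠ q}) => x i).classCard x = Fintype.card α := by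
  classical
  have : (Finset.univ.filter fun y =>
      Setoid.ker (fun (x : Fin k → α) (i : {i // i ≠ q}) => x i) x y) =
      Fintype.piFinset fun i => if i = q then Finset.univ else {x i} := by
    ext y
    simp only [Finset.mem_filter, Finset.mem_univ, true_and, Setoid.ker_def,
      Fintype.mem_piFinset, funext_iff, Subtype.forall]
    refine ⟨fun h i => ?_, fun h i hi => ?_⟩
    · split_ifs with hi
      · simp
      · simpa using (h i hi).symm
    · have : y i = x i := by simpa [hi] using h i
      exact this.symm
  rw [Setoid.classCard, this, Fintype.card_piFinset, ← Finset.mul_prod_erase _ _ (Finset.mem_univ q),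
    Finset.prod_congr rfl fun i hi => by rw [if_neg (Finset.ne_of_mem_erase hi)]]
  simp

theorem Setoid.classEntropy_ker_apply {k : ℕ} {α : Type*} [Fintype α] (i : Fin k) :
    (Setoid.ker fun x : Fin k → α => x i).classEntropy =
      Fintype.card (Fin k → α) * (((k : ℝ) - 1) * Real.logb 2 (Fintype.card α)) := by
  have hk : 1 ≤ k := i.pos
  simp only [classEntropy, classCard_ker_apply, Finset.sum_const, Finset.card_univ, nsmul_eq_mul]
  rw [Nat.cast_pow, Real.logb_pow, Nat.cast_sub hk, Nat.cast_one]

theorem Setoid.classEntropy_ker_others {k : ℕ} {α : Type*} [Fintype α] (q : Fin k) :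
    (Setoid.ker fun (x : Fin k → α) (i : {i // i ≠ q}) => x i).classEntropy =
      Fintype.card (Fin k → α) * Real.logb 2 (Fintype.card α) := by
  simp only [classEntropy, classCard_ker_others, Finset.sum_const, Finset.card_univ, nsmul_eq_mul]

namespace Protocol

variable {k : ℕ} {α : Type*} {Ω : Fin k → Type*} {P β : Type*}
  [∀ i, MeasurableSpace (Ω i)] [MeasurableSpace P] (π : Protocol k α Ω P β)

/-- Inputs that player `i` cannot distinguish at the end, for given random tapes. -/
def transcriptSetoid (r : (∀ i, Ω i) × P) (i : Fin k) : Setoid (Fin k → α) :=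
  Setoid.ker fun x => (x i, π.transcript x r i)

/-- Prior and posterior entropies are both instances of `condEntropy_comap_uniformOn_prod`; in the
posterior one the conditioning reveals all tapes, so the classes are those of the transcript for
fixed tapes. -/
theorem publicInfoCost_uniformOn [Fintype α] [Nonempty α] [MeasurableSpace α]
    [DiscreteMeasurableSpace α] (ρ : ∀ i, Measure (Ω i)) [∀ i, IsProbabilityMeasure (ρ i)]
    (τ : Measure P) [IsProbabilityMeasure τ]
    (hm : ∀ x i, DiscreteMeasurable inferInstance fun r => π.transcript x r i) :
    (∀ i, Integrable (fun r => (π.transcriptSetoid r i).classEntropy)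
      ((Measure.pi ρ).prod τ)) ∧
    π.publicInfoCost (uniformOn Set.univ) ρ τ =
      ∑ i, (((k : ℝ) - 1) * Real.logb 2 (Fintype.card α) - (Fintype.card (Fin k → α) : ℝ)⁻¹ *
        ∫ r, (π.transcriptSetoid r i).classEntropy ∂(Measure.pi ρ).prod τ) := by
  classical
  let _ : MeasurableSpace (List (List Bool)) := ⊤
  have hsplit : ∀ i (x y : Fin k → α), x i = y i →
      (fun q : {q // q ≠ i} => x q) = (fun q : {q // q ≠ i} => y q) → x = y := by
    intro i x y hi h
    funext q
    by_cases hq : q = i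
    · rw [hq, hi]
    · exact congrFun h ⟨q, hq⟩
  have hprior : ∀ i, condEntropy
      (MeasurableSpace.comap (fun s : (Fin k → α) × (∀ q, Ω q) × P => (s.1 i, s.2.1 i, s.2.2))
        inferInstance) ((uniformOn Set.univ).prod ((Measure.pi ρ).prod τ))
      (fun s (q : {q // q ≠ i}) => s.1 q) = ((k : ℝ) - 1) * Real.logb 2 (Fintype.card α) := by
    intro i
    have hG : Measurable fun s : (Fin k → α) × (∀ q, Ω q) × P => (s.1 i, s.2.1 i, s.2.2) := by
      fun_prop
    have hx : DiscreteMeasurable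
        (MeasurableSpace.comap (fun s : (Fin k → α) × (∀ q, Ω q) × P => (s.1 i, s.2.1 i, s.2.2))
          inferInstance) fun s : (Fin k → α) × (∀ q, Ω q) × P => s.1 i :=
      (measurable_fst.comp (comap_measurable _)).discreteMeasurable
    -- The tapes say nothing about the input, so the relation is constant in `r`; its classes can be
    -- read off although only part of the tapes is known.
    rw [(condEntropy_comap_uniformOn_prod ((Measure.pi ρ).prod τ) hG
      (fun _ => Setoid.ker fun x : Fin k → α => x i) (fun x (q : {q // q ≠ i}) => x q)
      (fun r x y hxy => by rw [Setoid.ker_def] at hxy; simp only [hxy])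
      (hx.map fun b => Finset.univ.filter fun y : Fin k → α => b = y i)
      (fun r x y => hsplit i x y)).2]
    rw [integral_const, Setoid.classEntropy_ker_apply]
    have : (Fintype.card (Fin k → α) : ℝ) ≠ 0 := by exact_mod_cast Fintype.card_ne_zero
    simp only [probReal_univ, one_smul]
    field_simp
  have hpost : ∀ i, Integrable (fun r => (π.transcriptSetoid r i).classEntropy)
        ((Measure.pi ρ).prod τ) ∧ condEntropy
      (MeasurableSpace.comap (fun s : (Fin k → α) × (∀ q, Ω q) × P =>
          π.transcript s.1 s.2 i) ⊤ ⊔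
        MeasurableSpace.comap (fun s (q : {q // q ≠ i}) => s.2.1 q) inferInstance ⊔
        MeasurableSpace.comap (fun s => (s.1 i, s.2.1 i, s.2.2)) inferInstance)
      ((uniformOn Set.univ).prod ((Measure.pi ρ).prod τ))
      (fun s (q : {q // q ≠ i}) => s.1 q) = (Fintype.card (Fin k → α) : ℝ)⁻¹ *
        ∫ r, (π.transcriptSetoid r i).classEntropy ∂(Measure.pi ρ).prod τ := by
    intro i
    rw [← MeasurableSpace.comap_prodMk, ← MeasurableSpace.comap_prodMk]
    set G : (Fin k → α) × (∀ q, Ω q) × P → _ := fun s =>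
      ((π.transcript s.1 s.2 i, fun q : {q // q ≠ i} => s.2.1 q), s.1 i, s.2.1 i, s.2.2)
    have htr : Measurable fun s : (Fin k → α) × (∀ q, Ω q) × P => π.transcript s.1 s.2 i :=
      (DiscreteMeasurable.bind (f := fun s : (Fin k → α) × (∀ q, Ω q) × P => s.1)
        (g := fun x s => π.transcript x s.2 i) measurable_fst.discreteMeasurable
        fun x => (hm x i).comp measurable_snd).measurable
    have hG : Measurable G := by fun_prop
    have hGc : Measurable[MeasurableSpace.comap G inferInstance] G := comap_measurable G
    have h1 : DiscreteMeasurable (MeasurableSpace.comap G inferInstance)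
        fun s => π.transcript s.1 s.2 i :=
      fun c => (measurable_fst.comp (measurable_fst.comp hGc))
        (show MeasurableSet[⊤] {c} from trivial)
    have h2 : DiscreteMeasurable (MeasurableSpace.comap G inferInstance)
        fun s : (Fin k → α) × (∀ q, Ω q) × P => s.1 i :=
      (measurable_fst.comp (measurable_snd.comp hGc)).discreteMeasurable
    have h3 : Measurable[MeasurableSpace.comap G inferInstance]
        fun s : (Fin k → α) × (∀ q, Ω q) × P => s.2 := by
      have hp : Measurable[MeasurableSpace.comap G inferInstance]
          fun s : (Fin k → α) × (∀ q, Ω q) × P => s.2.1 := by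
        refine @measurable_pi_lambda _ _ _ (MeasurableSpace.comap G inferInstance) _ _ fun q => ?_
        by_cases hq : q = i
        · subst hq
          exact measurable_fst.comp (measurable_snd.comp (measurable_snd.comp hGc))
        · exact (measurable_pi_apply (⟨q, hq⟩ : {q // q ≠ i})).comp
            (measurable_snd.comp (measurable_fst.comp hGc))
      have hpub := measurable_snd.comp (measurable_snd.comp (measurable_snd.comp hGc))
      exact hp.prodMk hpub
    -- The class of `x` depends on the transcripts of all inputs `y` under the actual tapes; these
    -- are functions of the tapes, which `G` determines.
    have h4 : DiscreteMeasurable (MeasurableSpace.comap G inferInstance)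
        fun (s : (Fin k → α) × (∀ q, Ω q) × P) y => π.transcript y s.2 i :=
      DiscreteMeasurable.pi fun y => (hm y i).comp h3
    refine condEntropy_comap_uniformOn_prod ((Measure.pi ρ).prod τ) hG
      (fun r => π.transcriptSetoid r i) (fun x (q : {q // q ≠ i}) => x q) ?_ ?_ ?_
    · intro r x y hxy
      obtain ⟨ha, hb⟩ := Prod.ext_iff.1 (Setoid.ker_def.1 hxy)
      simp only at ha hb
      simp only [G, ha, hb]
    · exact ((h2.prodMk h1).prodMk h4).bind fun c =>
        DiscreteMeasurable.const
          (@Finset.filter (Fin k → α) (fun y => c.1 = (y i, c.2 y))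
            (fun _ => Classical.propDecidable _) Finset.univ)
    · exact fun r x y hxy => hsplit i x y (Prod.ext_iff.1 (Setoid.ker_def.1 hxy)).1
  refine ⟨fun i => (hpost i).1, Finset.sum_congr rfl fun i _ => ?_⟩
  rw [condMutualInfo, hprior i, (hpost i).2]

/-! ### The entropy exchanged in an execution -/

/-- Inputs that player `i` cannot distinguish at time `t`. -/
def viewSetoid (r : (∀ i, Ω i) × P) (t : ℕ) (i : Fin k) : Setoid (Fin k → α) :=
  Setoid.ker fun x => (x i, π.run x r t i)

/-- Inputs that the players other than `q` together cannot distinguish at time `t`. -/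
def othersSetoid (r : (∀ i, Ω i) × P) (t : ℕ) (q : Fin k) : Setoid (Fin k → α) :=
  Setoid.ker fun x (i : {i // i ≠ q}) => (x i, π.run x r t i)

variable {π}

theorem viewSetoid_iff {r : (∀ i, Ω i) × P} {t : ℕ} {i : Fin k} {x y : Fin k → α} :
    π.viewSetoid r t i x y ↔ x i = y i ∧ π.run x r t i = π.run y r t i := by
  rw [viewSetoid, Setoid.ker_def, Prod.mk.injEq]

theorem othersSetoid_iff {r : (∀ i, Ω i) × P} {t : ℕ} {q : Fin k} {x y : Fin k → α} :
    π.othersSetoid r t q x y ↔ ∀ i, i ≠ q → x i = y i ∧ π.run x r t i = π.run y r t i := by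
  rw [othersSetoid, Setoid.ker_def]
  simp [funext_iff]

theorem transcriptSetoid_iff {r : (∀ i, Ω i) × P} {i : Fin k} {x y : Fin k → α} :
    π.transcriptSetoid r i x y ↔ x i = y i ∧ π.transcript x r i = π.transcript y r i := by
  rw [transcriptSetoid, Setoid.ker_def, Prod.mk.injEq]

theorem Oblivious.run_succ_eq (ho : π.Oblivious) (x y : Fin k → α) (r : (∀ i, Ω i) × P)
    (t : ℕ) (i : Fin k) (hrun : π.run x r t i = π.run y r t i)
    (hrec : ∀ q, π.received x r (π.run x r t) i q = π.received y r (π.run y r t) i q) :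
    π.run x r (t + 1) i = π.run y r (t + 1) i := by
  have hr := ho.ready_run_iff x y r r t i
  by_cases h : π.Ready x r (π.run x r t) i
  · rw [run, run, advance_of_ready h, advance_of_ready (hr.1 h), hrun, funext hrec]
  · rw [run, run, advance_of_not_ready h, advance_of_not_ready fun h' => h (hr.2 h'), hrun]

open Classical in
/-- In every step, the entropy received by the players is at least the entropy that they send. -/
theorem Oblivious.sum_othersSetoid_le_sum_viewSetoid [Fintype α] (ho : π.Oblivious)
    (r : (∀ i, Ω i) × P) (t : ℕ) :
    ∑ q, ((π.othersSetoid r 0 q).classEntropy - (π.othersSetoid r t q).classEntropy) ≤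
      ∑ i, ((π.viewSetoid r 0 i).classEntropy - (π.viewSetoid r t i).classEntropy) := by
  induction t with
  | zero => simp
  | succ t ih =>
    -- What `i` reads from `q` in this step. The value `none` of a player that does not advance
    -- carries no information, since advancing is independent of the input.
    let m (q i : Fin k) : Setoid (Fin k → α) := Setoid.ker fun x =>
      if π.Ready x r (π.run x r t) i then π.received x r (π.run x r t) i q else none
    have hbm : ∀ q q' i, q' ≠ q → i ≠ q → π.othersSetoid r t q ≤ m q' i := by
      intro q q' i hq hi x y hxy
      rw [othersSetoid_iff] at hxy
      simp only [m, Setoid.ker_def]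
      rw [received_congr (hxy q' hq).1 (hxy i hi).1 r (hxy q' hq).2 (hxy i hi).2]
      simp only [ho.ready_run_iff x y r r t i]
    have hstep := Setoid.sum_sub_refine_le (π.viewSetoid r t) (π.othersSetoid r t) m
      (fun q i hi x y hxy => viewSetoid_iff.2 (othersSetoid_iff.1 hxy i hi)) hbm
      (fun q => by
        refine top_unique fun x y _ => ?_
        simp [m, Setoid.ker_def, received_self])
    have ha : ∀ i, π.viewSetoid r (t + 1) i ≤ π.viewSetoid r t i ⊓ ⨅ q, m q i := by
      intro i
      have hv : ∀ {x y}, π.viewSetoid r (t + 1) i x y → π.run x r t i = π.run y r t i :=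
        fun hxy => ho.run_eq_of_run_eq t.le_succ (viewSetoid_iff.1 hxy).2
      refine le_inf (fun x y hxy => viewSetoid_iff.2 ⟨(viewSetoid_iff.1 hxy).1, hv hxy⟩)
        (le_iInf fun q x y hxy => ?_)
      have hr := ho.ready_run_iff x y r r t i
      simp only [m, Setoid.ker_def]
      by_cases h : π.Ready x r (π.run x r t) i
      · rw [if_pos h, if_pos (hr.1 h)]
        have h2 := (viewSetoid_iff.1 hxy).2
        rw [run, run, advance_of_ready h, advance_of_ready (hr.1 h), hv hxy,
          List.append_cancel_left_eq, List.singleton_inj] at h2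
        exact congrFun h2 q
      · rw [if_neg h, if_neg fun h' => h (hr.2 h')]
    -- The new state of the others is determined by their old one and the messages of `q`: a message
    -- between two of them is a function of their old joint state.
    have hb : ∀ q, π.othersSetoid r t q ⊓ ⨅ i, m q i ≤ π.othersSetoid r (t + 1) q := by
      intro q x y hxy
      obtain ⟨h1, h2⟩ : π.othersSetoid r t q x y ∧ (⨅ i, m q i) x y := hxy
      rw [othersSetoid_iff]
      intro i hi
      have h3 := othersSetoid_iff.1 h1 i hi
      have hr := ho.ready_run_iff x y r r t i
      refine ⟨h3.1, ?_⟩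
      by_cases h : π.Ready x r (π.run x r t) i
      · refine ho.run_succ_eq x y r t i h3.2 fun q' => ?_
        have h4 : m q' i x y := by
          by_cases hq : q' = q
          · subst hq
            exact (iInf_le (m q') i : (⨅ i, m q' i) ≤ m q' i) h2
          · exact hbm q q' i hq hi h1
        simp only [m, Setoid.ker_def] at h4
        rwa [if_pos h, if_pos (hr.1 h)] at h4
      · rw [run, run, advance_of_not_ready h, advance_of_not_ready fun h' => h (hr.2 h')]
        exact h3.2
    have ha' := Finset.sum_le_sum fun i (_ : i ∈ Finset.univ) => Setoid.classEntropy_mono (ha i)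
    have hb' := Finset.sum_le_sum fun q (_ : q ∈ Finset.univ) => Setoid.classEntropy_mono (hb q)
    simp only [Finset.sum_sub_distrib] at ih hstep ⊢
    linarith

theorem viewSetoid_zero (r : (∀ i, Ω i) × P) (i : Fin k) :
    π.viewSetoid r 0 i = Setoid.ker fun x : Fin k → α => x i := by
  ext x y
  simp [viewSetoid_iff, run, Setoid.ker_def]

theorem othersSetoid_zero (r : (∀ i, Ω i) × P) (q : Fin k) :
    π.othersSetoid r 0 q = Setoid.ker fun (x : Fin k → α) (i : {i // i ≠ q}) => x i := by
  ext x y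
  simp [othersSetoid_iff, run, Setoid.ker_def, funext_iff]

end Protocol

/-! ### The lower bound -/

/-- The terms at indices other than `q` cancel. The general starting values `b` and `c` are needed
for the induction. -/
theorem List.xor_foldl_xor {γ : Type*} [DecidableEq γ] (f g : γ → Bool) (q : γ) (l : List γ)
    (hl : l.Nodup) (hfg : ∀ i, i ≠ q → f i = g i) (b c : Bool) :
    ((l.foldl (fun b i => b ^^ f i) b) ^^ (l.foldl (fun b i => b ^^ g i) c)) =
      ((b ^^ c) ^^ if q ∈ l then f q ^^ g q else false) := by
  induction l generalizing b c with
  | nil => simp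
  | cons a l ih =>
    rw [List.nodup_cons] at hl
    rw [List.foldl_cons, List.foldl_cons, ih hl.2]
    by_cases ha : a = q
    · subst ha
      simp only [hl.1, if_false, List.mem_cons, true_or, if_true]
      cases b <;> cases c <;> cases f a <;> cases g a <;> rfl
    · have : q ≠ a := Ne.symm ha
      simp only [List.mem_cons, this, false_or, hfg a ha]
      cases b <;> cases c <;> cases g a <;> rfl

theorem eq_of_parity_eq {k n : ℕ} {x y : Fin k → Fin n → Bool} {q : Fin k} {p : Fin n}
    (h : ∀ i, i ≠ q → x i = y i) (hp : parity x p = parity y p) : x q p = y q p := by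
  have := List.xor_foldl_xor (fun i => x i p) (fun i => y i p) q (List.finRange k)
    (List.nodup_finRange k) (fun i hi => by rw [h i hi]) false false
  rw [← parity, ← parity, hp] at this
  simpa using this

/-- Within the class only the bits of `x q` outside `S` are free. -/
theorem Setoid.classCard_le_two_pow {k n : ℕ} (s : Setoid (Fin k → Fin n → Bool)) (q : Fin k)
    (x : Fin k → Fin n → Bool) (S : Finset (Fin n))
    (hs : ∀ y, s x y → (∀ i, i ≠ q → x i = y i) ∧ ∀ p ∈ S, x q p = y q p) :
    s.classCard x ≤ 2 ^ (n - S.card) := by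
  classical
  have hcard : (Finset.univ : Finset ({p // p ∉ S} → Bool)).card = 2 ^ (n - S.card) := by
    simp [Fintype.card_subtype_compl]
  rw [Setoid.classCard, ← hcard]
  refine Finset.card_le_card_of_injOn (fun y p => y q p) (fun _ _ => Finset.mem_univ _) ?_
  intro y hy z hz hyz
  simp only [Finset.coe_filter, Finset.mem_univ, true_and, Set.mem_ofPred_eq] at hy hz
  funext i p
  by_cases hi : i = q
  · subst hi
    by_cases hp : p ∈ S
    · rw [← (hs y hy).2 p hp, (hs z hz).2 p hp]
    · exact congrFun hyz ⟨p, hp⟩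
  · rw [← (hs y hy).1 i hi, (hs z hz).1 i hi]

theorem logb_card_fin_bool (n : ℕ) : Real.logb 2 (Fintype.card (Fin n → Bool)) = n := by
  simp [Real.logb_pow]

namespace Protocol

variable {k n : ℕ} {Ω : Fin k → Type*} {P β : Type*}
  [∀ i, MeasurableSpace (Ω i)] [MeasurableSpace P]
  {π : Protocol k (Fin n → Bool) Ω P β}

open Classical in
/-- If for given random tapes every bit of the parity is known to some player at some time, then
the transcripts carry at least `n (k - 1)` bits of information. -/
theorem Oblivious.le_sum_classEntropy (ho : π.Oblivious) (hs : π.Stops)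
    (r : (∀ i, Ω i) × P)
    (hdec : ∀ x p, ∃ i t, ∀ y, x i = y i → π.run x r t i = π.run y r t i →
      parity x p = parity y p) :
    (Fintype.card (Fin k → Fin n → Bool) : ℝ) * (n * ((k : ℝ) - 1)) ≤
      ∑ i, (Fintype.card (Fin k → Fin n → Bool) * (((k : ℝ) - 1) * n) -
        (π.transcriptSetoid r i).classEntropy) := by
  have : Nonempty ((∀ i, Ω i) × P) := ⟨r⟩
  obtain ⟨T₀, hT₀⟩ := ho.exists_transcript_eq hs
  -- The player `d x p` who knows coordinate `p` may vary with the input; the count below is made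
  -- separately for each `x`.
  choose d t hd using hdec
  -- Late enough for all transcripts to be complete and all parity bits to be known.
  set T := max T₀ (∑ x, ∑ p, t x p)
  have htT : ∀ x p, t x p ≤ T := fun x p =>
    ((Finset.single_le_sum (f := fun p => t x p) (fun _ _ => Nat.zero_le _)
      (Finset.mem_univ p)).trans (Finset.single_le_sum (f := fun x => ∑ p, t x p)
      (fun _ _ => Nat.zero_le _) (Finset.mem_univ x))).trans (le_max_right _ _)
  have htrans : ∀ i, (π.transcriptSetoid r i).classEntropy ≤
      (π.viewSetoid r T i).classEntropy := by
    refine fun i => Setoid.classEntropy_mono fun x y hxy => ?_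
    rw [transcriptSetoid_iff, hT₀ T (le_max_left _ _), hT₀ T (le_max_left _ _)] at hxy
    exact viewSetoid_iff.2 ⟨hxy.1, eq_of_messagesRead_eq (ho.shape_run_eq x y r r T i) hxy.2⟩
  have hothers : ∀ q, (π.othersSetoid r T q).classEntropy ≤
      ∑ x, ((n : ℝ) - (Finset.univ.filter fun p => d x p ≠ q).card) := by
    refine fun q => Finset.sum_le_sum fun x _ => ?_
    have hcard := (π.othersSetoid r T q).classCard_le_two_pow q x
      (Finset.univ.filter fun p => d x p ≠ q) fun y hxy => by
        rw [othersSetoid_iff] at hxy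
        refine ⟨fun i hi => (hxy i hi).1, fun p hp => ?_⟩
        have h := hxy _ (Finset.mem_filter.1 hp).2
        exact eq_of_parity_eq (fun i hi => (hxy i hi).1)
          (hd x p y h.1 (ho.run_eq_of_run_eq (htT x p) h.2))
    have hle : (Finset.univ.filter fun p => d x p ≠ q).card ≤ n := by
      simpa using Finset.card_filter_le (Finset.univ : Finset (Fin n)) fun p => d x p ≠ q
    calc Real.logb 2 ((π.othersSetoid r T q).classCard x)
        ≤ Real.logb 2 ((2 : ℝ) ^ (n - (Finset.univ.filter fun p => d x p ≠ q).card)) :=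
          Real.logb_le_logb_of_le (by norm_num)
            (by exact_mod_cast Setoid.classCard_pos _ x) (by exact_mod_cast hcard)
      _ = _ := by
          rw [Real.logb_pow, Real.logb_self_eq_one (by norm_num), mul_one, Nat.cast_sub hle]
  have hcount : ∀ x, ∑ q, ((Finset.univ.filter fun p => d x p ≠ q).card : ℝ) =
      n * ((k : ℝ) - 1) := by
    intro x
    -- Every coordinate counts for all `q` except the one player chosen to know it.
    have : ∀ p, ∑ q, (if d x p ≠ q then (1 : ℝ) else 0) = (k : ℝ) - 1 := by
      intro p
      rw [← Finset.sum_filter, Finset.sum_const, nsmul_eq_mul, mul_one, Finset.filter_ne,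
        Finset.card_erase_of_mem (Finset.mem_univ _), Finset.card_univ, Fintype.card_fin,
        Nat.cast_sub (d x p).pos, Nat.cast_one]
    simp_rw [Finset.card_filter, Nat.cast_sum, Nat.cast_ite, Nat.cast_one, Nat.cast_zero]
    rw [Finset.sum_comm]
    simp_rw [this]
    rw [Finset.sum_const, nsmul_eq_mul, Finset.card_univ, Fintype.card_fin]
  have hmain := ho.sum_othersSetoid_le_sum_viewSetoid r T
  simp only [viewSetoid_zero, othersSetoid_zero, Setoid.classEntropy_ker_apply,
    Setoid.classEntropy_ker_others, logb_card_fin_bool] at hmain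
  have h1 := Finset.sum_le_sum fun i (_ : i ∈ Finset.univ) => htrans i
  have h2 := Finset.sum_le_sum fun q (_ : q ∈ Finset.univ) => hothers q
  have h3 : ∑ q : Fin k, ∑ x : Fin k → Fin n → Bool,
      ((n : ℝ) - (Finset.univ.filter fun p => d x p ≠ q).card) =
      ∑ q : Fin k, (Fintype.card (Fin k → Fin n → Bool) : ℝ) * n -
        Fintype.card (Fin k → Fin n → Bool) * (n * ((k : ℝ) - 1)) := by
    simp only [Finset.sum_sub_distrib]
    rw [Finset.sum_comm (f := fun q x => ((Finset.univ.filter fun p => d x p ≠ q).card : ℝ))]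
    simp_rw [hcount]
    simp
  simp only [Finset.sum_sub_distrib] at hmain ⊢
  linarith

/-- The bound for fixed tapes, integrated over the tapes and divided by the number of inputs. -/
theorem Oblivious.le_publicInfoCost (ho : π.Oblivious) (hs : π.Stops)
    (ρ : ∀ i, Measure (Ω i)) [∀ i, IsProbabilityMeasure (ρ i)]
    (τ : Measure P) [IsProbabilityMeasure τ]
    (hdec : ∀ᵐ r ∂(Measure.pi ρ).prod τ, ∀ x p, ∃ i t, ∀ y, x i = y i →
      π.run x r t i = π.run y r t i → parity x p = parity y p) :
    (n : ℝ) * ((k : ℝ) - 1) ≤ π.publicInfoCost (uniformInput k n) ρ τ := by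
  have : Nonempty ((∀ i, Ω i) × P) := ((Measure.pi ρ).prod τ).nonempty_of_neZero
  obtain ⟨hi, hc⟩ := π.publicInfoCost_uniformOn ρ τ
    fun x i => ho.discreteMeasurable_transcript hs x i
  rw [uniformInput, hc, logb_card_fin_bool]
  set C : ℝ := ((Fintype.card (Fin k → Fin n → Bool) : ℕ) : ℝ)
  have hC : 0 < C := by simp only [C]; exact_mod_cast Fintype.card_pos
  have hint : ∫ r, ∑ i, (C * (((k : ℝ) - 1) * n) - (π.transcriptSetoid r i).classEntropy)
      ∂(Measure.pi ρ).prod τ = ∑ i : Fin k, (C * (((k : ℝ) - 1) * n) -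
        ∫ r, (π.transcriptSetoid r i).classEntropy ∂(Measure.pi ρ).prod τ) := by
    rw [integral_finsetSum Finset.univ (f := fun i r =>
      C * (((k : ℝ) - 1) * n) - (π.transcriptSetoid r i).classEntropy)
      fun i _ => (integrable_const _).sub (hi i)]
    refine Finset.sum_congr rfl fun i _ => ?_
    rw [integral_sub (integrable_const _) (hi i)]
    simp
  have hle : C * (n * ((k : ℝ) - 1)) ≤ ∑ i : Fin k, (C * (((k : ℝ) - 1) * n) -
        ∫ r, (π.transcriptSetoid r i).classEntropy ∂(Measure.pi ρ).prod τ) := by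
    rw [← hint]
    calc C * (n * ((k : ℝ) - 1)) = ∫ _, C * (n * ((k : ℝ) - 1)) ∂(Measure.pi ρ).prod τ := by simp
      _ ≤ _ := by
        refine integral_mono_ae (integrable_const _)
          (integrable_finsetSum _ fun i _ => (integrable_const _).sub (hi i)) ?_
        filter_upwards [hdec] with r hr
        exact ho.le_sum_classEntropy hs r hr
  rw [mul_comm, ← le_div_iff₀ hC, Finset.sum_div] at hle
  refine hle.trans (le_of_eq (Finset.sum_congr rfl fun i _ => ?_))
  field_simp

theorem le_publicInfoCost_of_computesParity [NeZero k]
    {π : Protocol k (Fin n → Bool) Ω P (Fin n → Bool)} (ho : π.Oblivious) (hs : π.Stops)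
    (ρ : ∀ i, Measure (Ω i)) [∀ i, IsProbabilityMeasure (ρ i)]
    (τ : Measure P) [IsProbabilityMeasure τ] (hπ : ComputesParity π ρ τ) :
    (n : ℝ) * ((k : ℝ) - 1) ≤ π.publicInfoCost (uniformInput k n) ρ τ := by
  refine ho.le_publicInfoCost hs ρ τ ?_
  -- There are finitely many inputs, so one null set of tapes covers them all. Outside it, two
  -- inputs with the same view of the writer give the same output, correct for both, hence the same
  -- parity.
  filter_upwards [ae_all_iff.2 fun x => (hπ x).2] with r hr x p
  obtain ⟨y, t, ht⟩ := (hπ x).1 r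
  refine ⟨0, t, fun x' h0 hrun => ?_⟩
  rw [← hr x y ⟨t, ht⟩, ← hr x' y ⟨t, by rw [← hrun, ← view_congr h0, ht]⟩]

theorem le_publicInfoCost_of_computesParityJointly
    {π : Protocol k (Fin n → Bool) Ω P (Fin n → Option Bool)} (ho : π.Oblivious) (hs : π.Stops)
    (ρ : ∀ i, Measure (Ω i)) [∀ i, IsProbabilityMeasure (ρ i)]
    (τ : Measure P) [IsProbabilityMeasure τ] (hπ : ComputesParityJointly π ρ τ) :
    (n : ℝ) * ((k : ℝ) - 1) ≤ π.publicInfoCost (uniformInput k n) ρ τ := by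
  refine ho.le_publicInfoCost hs ρ τ ?_
  filter_upwards [ae_all_iff.2 fun x => (hπ x).2] with r hr x p
  obtain ⟨i, y, ⟨t, ht⟩, hy⟩ := (hπ x).1 r p
  obtain ⟨b, hb⟩ := Option.isSome_iff_exists.1 hy
  refine ⟨i, t, fun x' h0 hrun => ?_⟩
  rw [← hr x i y ⟨t, ht⟩ p b hb,
    ← hr x' i y ⟨t, by rw [← hrun, ← view_congr h0, ht]⟩ p b hb]

/-! ### The protocol in which all players send their inputs to the first player -/

section Star

variable [NeZero k]

/-- The inputs of all players, as known to the first player after the first round. -/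
def starInputs (a : Fin n → Bool) (h : History k) (q : Fin k) (p : Fin n) : Bool :=
  if q = 0 then a p else ((h.headD fun _ => none) q |>.getD []).getD p false

variable (k n Ω P) in
/-- In the first round, all players send their inputs to the first player, who then outputs the
parity in the format given by `f`. -/
def star (f : (Fin n → Bool) → β) : Protocol k (Fin n → Bool) Ω P β where
  sendTo i v := if i ≠ 0 ∧ v.received.length = 0 then {0} else ∅
  message _ v _ := List.ofFn v.input
  output i v :=
    if i = 0 ∧ v.received.length = 1 then some (f (parity (starInputs v.input v.received)))
    else none
  waitFor i v := if i = 0 ∧ v.received.length = 0 then Finset.univ.erase 0 else ∅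
  notMem_sendTo i v := by
    split_ifs with h
    · simpa using h.1
    · simp
  notMem_waitFor i v := by
    split_ifs with h
    · simp [h.1]
    · simp
  measurable_sendTo i _ h s := DiscreteMeasurable.const
    (if i ≠ 0 ∧ h.length = 0 then {0} else ∅) s
  measurable_message _ a _ _ s := DiscreteMeasurable.const (List.ofFn a) s
  measurable_output i a h s := DiscreteMeasurable.const
    (if i = 0 ∧ h.length = 1 then some (f (parity (starInputs a h))) else none) s
  measurable_waitFor i _ h s := DiscreteMeasurable.const
    (if i = 0 ∧ h.length = 0 then Finset.univ.erase 0 else ∅) s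

variable (f : (Fin n → Bool) → β)

theorem star_oblivious : (star k n Ω P f).Oblivious :=
  ⟨fun i j => if i ≠ 0 ∧ j = 0 then {0} else ∅,
    fun i j => if i = 0 ∧ j = 0 then Finset.univ.erase 0 else ∅, fun _ _ => ⟨rfl, rfl⟩⟩

theorem star_selfDelimiting : (star k n Ω P f).SelfDelimiting :=
  fun _ _ v w _ _ h => h.eq_of_length (by simp [star])

theorem star_sent (x : Fin k → Fin n → Bool) (r : (∀ i, Ω i) × P) (q i : Fin k)
    (h : History k) :
    (star k n Ω P f).sent x r q i h = if q ≠ 0 ∧ i = 0 then [List.ofFn (x q)] else [] := by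
  rw [sent, List.range_succ_eq_map, List.filterMap_cons, List.filterMap_map,
    List.filterMap_eq_nil_iff.2]
  · by_cases hq : q = 0 <;> by_cases hi : i = 0 <;> simp [star, view, hq, hi]
  · intro j hj
    have : j < h.length := List.mem_range.1 hj
    have h' : h ≠ [] := by rintro rfl; simp at this
    simp [star, view, h']

theorem star_stops : (star k n Ω P f).Stops :=
  fun x r => ⟨0, fun t _ q i => by rw [star_sent, star_sent]⟩

/-- The messages read by player `i` in the first round. -/
def starMessages (x : Fin k → Fin n → Bool) (i q : Fin k) : Option (List Bool) :=
  if i = 0 ∧ q ≠ 0 then some (List.ofFn (x q)) else none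

/-- After the first round nobody waits for anything, so every step completes an empty round and
histories keep growing; `messagesRead` ignores these rounds. -/
theorem star_run_succ (x : Fin k → Fin n → Bool) (r : (∀ i, Ω i) × P) (t : ℕ) (i : Fin k) :
    (star k n Ω P f).run x r (t + 1) i =
      starMessages x i :: List.replicate t fun _ => none := by
  induction t with
  | zero =>
    have hnext : ∀ q, i = 0 → q ≠ 0 → (star k n Ω P f).nextMessage x r
        ((star k n Ω P f).run x r 0) q i = some (List.ofFn (x q)) := fun q hi hq => by
      rw [nextMessage, star_sent, if_pos ⟨hq, hi⟩]
      simp [run]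
    have hwait : ∀ q, q ∈ (star k n Ω P f).waitFor i (view x r i
        ((star k n Ω P f).run x r 0 i)) ↔ i = 0 ∧ q ≠ 0 := fun q => by
      by_cases hi : i = 0 <;> simp [star, view, run, hi]
    rw [run, advance_of_ready]
    · rw [List.replicate_zero, show (star k n Ω P f).run x r 0 i = [] from rfl, List.nil_append]
      congr 1
      funext q
      unfold received starMessages
      by_cases h : i = 0 ∧ q ≠ 0
      · rw [if_pos ((hwait q).2 h), if_pos h]
        exact hnext q h.1 h.2
      · rw [if_neg (fun h' => h ((hwait q).1 h')), if_neg h]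
    · intro q hq
      rw [hwait] at hq
      rw [hnext q hq.1 hq.2]
      rfl
  | succ t ih =>
    have hwait : (star k n Ω P f).waitFor i (view x r i
        ((star k n Ω P f).run x r (t + 1) i)) = ∅ := by
      rw [ih]; simp [star, view]
    rw [run, advance_of_ready]
    · rw [ih, List.replicate_succ', List.cons_append]
      congr 3
      funext q
      unfold received
      rw [hwait]
      simp
    · intro q hq
      rw [hwait] at hq
      simp at hq

theorem star_length_run (x : Fin k → Fin n → Bool) (r : (∀ i, Ω i) × P) (t : ℕ) (i : Fin k) :
    ((star k n Ω P f).run x r t i).length = t := by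
  cases t with
  | zero => rfl
  | succ t => simp [star_run_succ]

theorem star_writes_iff (x : Fin k → Fin n → Bool) (r : (∀ i, Ω i) × P) (i : Fin k) (y : β) :
    (star k n Ω P f).Writes x r i y ↔ i = 0 ∧ y = f (parity x) := by
  have hin : ∀ i : Fin k, i = 0 →
      starInputs (x i) ((star k n Ω P f).run x r 1 i) = x := by
    rintro i rfl
    rw [star_run_succ (t := 0)]
    funext q p
    by_cases hq : q = 0
    · simp [starInputs, hq]
    · simp [starInputs, hq, starMessages]
  have hout : ∀ t, (star k n Ω P f).output i (view x r i ((star k n Ω P f).run x r t i)) =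
      if i = 0 ∧ t = 1 then some (f (parity x)) else none := by
    intro t
    have hl := star_length_run f x r t i
    by_cases h : i = 0 ∧ t = 1
    · obtain ⟨h0, rfl⟩ := h
      change (if i = 0 ∧ ((star k n Ω P f).run x r 1 i).length = 1 then
        some (f (parity (starInputs (x i) ((star k n Ω P f).run x r 1 i)))) else none) = _
      rw [hl, hin i h0]
    · change (if i = 0 ∧ ((star k n Ω P f).run x r t i).length = 1 then
        some (f (parity (starInputs (x i) ((star k n Ω P f).run x r t i)))) else none) = _
      rw [hl, if_neg h, if_neg h]
  simp only [Writes, hout]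
  constructor
  · rintro ⟨t, ht⟩
    split_ifs at ht with h
    exact ⟨h.1, (Option.some.inj ht).symm⟩
  · rintro ⟨h, rfl⟩
    exact ⟨1, if_pos ⟨h, rfl⟩⟩

theorem star_writesOnce : (star k n Ω P f).WritesOnce := by
  have : ∀ i v, ((star k n Ω P f).output i v).isSome → v.received.length = 1 := by
    intro i v h
    by_contra h'
    simp [star, h'] at h
  intro x r i s t hs ht
  exact (this _ _ hs).trans (this _ _ ht).symm

theorem star_publicInfoCost (ρ : ∀ i, Measure (Ω i)) [∀ i, IsProbabilityMeasure (ρ i)]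
    (τ : Measure P) [IsProbabilityMeasure τ] :
    (star k n Ω P f).publicInfoCost (uniformInput k n) ρ τ = n * ((k : ℝ) - 1) := by
  have : Nonempty ((∀ i, Ω i) × P) := ((Measure.pi ρ).prod τ).nonempty_of_neZero
  have ho := star_oblivious (Ω := Ω) (P := P) f
  have hs := star_stops (Ω := Ω) (P := P) f
  obtain ⟨-, hc⟩ := (star k n Ω P f).publicInfoCost_uniformOn ρ τ
    fun x i => ho.discreteMeasurable_transcript hs x i
  obtain ⟨T, hT⟩ := ho.exists_transcript_eq hs
  have hzero : ∀ r, ((star k n Ω P f).transcriptSetoid r 0).classEntropy = 0 := by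
    intro r
    refine Finset.sum_eq_zero fun x _ => ?_
    have : ((star k n Ω P f).transcriptSetoid r 0).classCard x = 1 := by
      refine Finset.card_eq_one.2 ⟨x, Finset.ext fun y => ?_⟩
      simp only [Finset.mem_filter, Finset.mem_univ, true_and, Finset.mem_singleton]
      refine ⟨fun h => ?_, fun h => h ▸ Setoid.refl' _ _⟩
      rw [transcriptSetoid_iff, hT (T + 1) T.le_succ, hT (T + 1) T.le_succ] at h
      have h2 := eq_of_messagesRead_eq (ho.shape_run_eq x y r r (T + 1) 0) h.2
      rw [star_run_succ, star_run_succ] at h2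
      funext q
      by_cases hq : q = 0
      · rw [hq, h.1]
      · have := congrFun (List.cons.inj h2).1 q
        simp only [starMessages, hq, ne_eq, not_false_eq_true, and_self, if_true,
          Option.some.injEq] at this
        exact (List.ofFn_injective this).symm
    simp [this]
  have hother : ∀ r i, i ≠ 0 → (star k n Ω P f).transcriptSetoid r i =
      Setoid.ker fun x : Fin k → Fin n → Bool => x i := by
    intro r i hi
    ext x y
    rw [transcriptSetoid_iff, hT (T + 1) T.le_succ, hT (T + 1) T.le_succ, star_run_succ,
      star_run_succ]
    have : starMessages x i = starMessages y i := by
      funext q; simp [starMessages, hi]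
    simp [Setoid.ker_def, this]
  have hC : (Fintype.card (Fin k → Fin n → Bool) : ℝ) ≠ 0 := by
    exact_mod_cast Fintype.card_ne_zero
  -- Only the first player learns anything: its final classes are singletons, while those of the
  -- others stay as they were.
  rw [uniformInput, hc, logb_card_fin_bool, Finset.sum_eq_single 0]
  · simp only [hzero, integral_zero]
    ring
  · intro i _ hi
    simp only [hother _ i hi, Setoid.classEntropy_ker_apply, logb_card_fin_bool, integral_const,
      probReal_univ, one_smul]
    field_simp
    ring
  · simp

theorem mem_obliviousCosts (ρ : ∀ i, Measure (Ω i)) [∀ i, IsProbabilityMeasure (ρ i)]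
    (τ : Measure P) [IsProbabilityMeasure τ]
    {C : Protocol k (Fin n → Bool) Ω P β → Prop} (hC : C (star k n Ω P f)) :
    (n : ℝ) * ((k : ℝ) - 1) ∈ obliviousCosts C ρ τ :=
  ⟨star k n Ω P f, star_oblivious f, star_stops f, star_writesOnce f, star_selfDelimiting f, hC,
    star_publicInfoCost f ρ τ⟩

theorem star_computesParity (ρ : ∀ i, Measure (Ω i)) (τ : Measure P) :
    ComputesParity (star k n Ω P id) ρ τ := by
  intro x
  simp [star_writes_iff]

theorem star_computesParityJointly (ρ : ∀ i, Measure (Ω i)) (τ : Measure P) :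
    ComputesParityJointly (star k n Ω P fun y p => some (y p)) ρ τ := by
  intro x
  refine ⟨fun r p => ⟨0, _, (star_writes_iff _ x r 0 _).2 ⟨rfl, rfl⟩, rfl⟩,
    Filter.Eventually.of_forall fun r i y hy p b hb => ?_⟩
  rw [((star_writes_iff _ x r i y).1 hy).2] at hb
  exact (Option.some.inj hb).symm

end Star

end Protocol

end

/-! ### Lower bounds and tightness combined -/

theorem mainTheorem1 (k n : ℕ) [NeZero k] {Ω : Fin k → Type*} {P : Type*}
    [∀ i, MeasurableSpace (Ω i)] [MeasurableSpace P]
    (ρ : ∀ i, Measure (Ω i)) [∀ i, IsProbabilityMeasure (ρ i)]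
    (τ : Measure P) [IsProbabilityMeasure τ] :
    -- the lower bound for every protocol (self-delimiting or not)
    (∀ π : Protocol k (Fin n → Bool) Ω P (Fin n → Bool),
      π.Oblivious → π.Stops → π.WritesOnce → ComputesParity π ρ τ →
        (n : ℝ) * ((k : ℝ) - 1) ≤ π.publicInfoCost (uniformInput k n) ρ τ) ∧
    -- also if any player may output any of the coordinates
    (∀ π : Protocol k (Fin n → Bool) Ω P (Fin n → Option Bool),
      π.Oblivious → π.Stops → π.WritesOnce → ComputesParityJointly π ρ τ →
        (n : ℝ) * ((k : ℝ) - 1) ≤ π.publicInfoCost (uniformInput k n) ρ τ) ∧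
    -- tightness: the bounds are attained, and are the values of the complexities
    (n : ℝ) * ((k : ℝ) - 1) ∈
      obliviousCosts (k := k) (n := n) (fun π => ComputesParity π ρ τ) ρ τ ∧
    (n : ℝ) * ((k : ℝ) - 1) ∈
      obliviousCosts (k := k) (n := n) (fun π => ComputesParityJointly π ρ τ) ρ τ ∧
    parityPIC k n ρ τ = (n : ℝ) * ((k : ℝ) - 1) ∧
    jointParityPIC k n ρ τ = (n : ℝ) * ((k : ℝ) - 1) := by
  have lower : ∀ π : Protocol k (Fin n → Bool) Ω P (Fin n → Bool), π.Oblivious → π.Stops →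
      ComputesParity π ρ τ → (n : ℝ) * ((k : ℝ) - 1) ≤ π.publicInfoCost (uniformInput k n) ρ τ :=
    fun _ ho hs hπ => Protocol.le_publicInfoCost_of_computesParity ho hs ρ τ hπ
  have lowerJoint : ∀ π : Protocol k (Fin n → Bool) Ω P (Fin n → Option Bool),
      π.Oblivious → π.Stops → ComputesParityJointly π ρ τ →
        (n : ℝ) * ((k : ℝ) - 1) ≤ π.publicInfoCost (uniformInput k n) ρ τ :=
    fun _ ho hs hπ => Protocol.le_publicInfoCost_of_computesParityJointly ho hs ρ τ hπ
  have mem := Protocol.mem_obliviousCosts id ρ τ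
    (C := fun π => ComputesParity π ρ τ) (Protocol.star_computesParity (k := k) (n := n) ρ τ)
  have memJoint := Protocol.mem_obliviousCosts (fun (y : Fin n → Bool) p => some (y p)) ρ τ
    (C := fun π => ComputesParityJointly π ρ τ)
    (Protocol.star_computesParityJointly (k := k) (n := n) ρ τ)
  refine ⟨fun π ho hs _ hπ => lower π ho hs hπ, fun π ho hs _ hπ => lowerJoint π ho hs hπ,
    mem, memJoint, IsLeast.csInf_eq ⟨mem, ?_⟩, IsLeast.csInf_eq ⟨memJoint, ?_⟩⟩
  · rintro c ⟨π, ho, hs, -, -, hπ, rfl⟩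
    exact lower π ho hs hπ
  · rintro c ⟨π, ho, hs, -, -, hπ, rfl⟩
    exact lowerJoint π ho hs hπ
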